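/- Let $\mathcal A=\{H_0,\dots,H_n\}$ be an arrangement of distinct hyperplanes in $\mathbb P^\ell=\mathbb P^\ell(\mathbb C)$, $H_j=\ker\alpha_j$ with nonzero linear forms $\alpha_j$, coordinates being chosen so that $\alpha_0=x_0$. Put $f_j(x)=\alpha_j(1,x_1,\dots,x_\ell)$ and let $U=\mathbb P^\ell-\bigcup_j H_j=\{x\in\mathbb C^\ell: f_j(x)\ne 0 \text{ for all } j\}$. For $w\in\mathbb C^{n+1}$ let $\Phi_w=\prod_{j=0}^n f_j^{w_j}$, let $\omega_w=\mathrm d\log\Phi_w=\sum_j w_j\,\mathrm d\log f_j$, a one-form on $U$, and let $\operatorname{crit}(\Phi_w)=\{x\in U:\omega_w(x)=0\}$. Let $\Lambda=(\xi_1,\dots,\xi_q)$ with $\xi_i=(\xi_{i0},\dots,\xi_{in})\in\mathbb Z^{n+1}$ and $\sum_j\xi_{ij}=0$ be such that $\omega_{\xi_1},\dots,\omega_{\xi_q}$ are linearly independent over $\mathbb C$, and let $D$ be their span. The rank of $D$ is the largest $p$ such that some product $\eta_1\wedge\cdots\wedge\eta_p$ of elements of $D$ is not identically zero on $U$. Let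 $\Phi_\Lambda=[1:\Phi_{\xi_1}:\cdots:\Phi_{\xi_q}]:U\to\mathbb P^q$, let $\bar Y$ be the Zariski closure of $\Phi_\Lambda(U)$ in $\mathbb P^q$, and let $\nu_0,\dots,\nu_q\in\mathbb Z_{\ge0}^{n+1}$ be the vectors with $\xi_i=\nu_i-\nu_0$ for $1\le i\le q$ and $\min_i\nu_{ij}=0$ for each $j$ (so that $\Phi_\Lambda=[\Phi_{\nu_0}:\cdots:\Phi_{\nu_q}]$ without common factors). Let $\operatorname{Sing}(\Phi_\Lambda)$ be the set of points of $U$ at which the Jacobian of $(\Phi_{\xi_1},\dots,\Phi_{\xi_q})$ does not attain its maximal rank on $U$, let $\operatorname{Sing}(\bar Y)$ be the singular locus of $\bar Y$, and let $S_\Lambda=\operatorname{Sing}(\Phi_\Lambda)\cup\Phi_\Lambda^{-1}(\operatorname{Sing}(\bar Y))\subseteq U$. Suppose that $\bar Y$ is a hyperplane $\{\sum_{j=0}^q b_jz_j=0\}$ with $b_j\neq0$ for all $0\le j\le q$. Then for generic $a\in\mathbb C^{q+1}$ with $\sum_{i=0}^q a_i=0$ (that is, for all $a$ in a nonempty Zariski-open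 subset of this linear space) and $\lambda=\sum_{i=0}^q a_i\nu_i$, the set $\operatorname{crit}(\Phi_\lambda)-S_\Lambda$ is nonempty, and each of its irreducible components has codimension equal to the rank of $D$. -/

import Mathlib

noncomputable section

open scoped LinearAlgebra.Projectivization

namespace CritLocus

/-- An arrangement of `n + 1` distinct hyperplanes in `ℙ^ℓ` over `ℂ`, given by nonzero linear forms
`α 0, …, α n` in the homogeneous coordinates `x 0, …, x ℓ`, normalised so that `α 0 = x 0`. -/
structure Arrangement (ℓ n : ℕ) where
  α : Fin (n + 1) → Module.Dual ℂ (Fin (ℓ + 1) → ℂ)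
  ne_zero : ∀ j, α j ≠ 0
  distinct : Function.Injective fun j => LinearMap.ker (α j)
  normalised : α 0 = LinearMap.proj 0

namespace Arrangement

variable {ℓ n : ℕ} (A : Arrangement ℓ n)

/-- The defining polynomial function `f j x = α j (1, x)` in the chart `x 0 = 1`, so `f 0 = 1`. -/
def f (j : Fin (n + 1)) (x : Fin ℓ → ℂ) : ℂ := A.α j (Fin.cons 1 x)

/-- The complement of the arrangement. Since `H 0` is the hyperplane at infinity, it lies in
`ℂ^ℓ = ℙ^ℓ - H 0`. -/
def U : Set (Fin ℓ → ℂ) := {x | ∀ j, A.f j x ≠ 0}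

/-- The one-form `d log f_j` on `U`. -/
def dlog (j : Fin (n + 1)) : A.U → Module.Dual ℂ (Fin ℓ → ℂ) := fun x =>
  (A.f j x)⁻¹ • (fderiv ℂ (A.f j) x : (Fin ℓ → ℂ) →ₗ[ℂ] ℂ)

/-- The one-form `ω_w = d log Φ_w = ∑ j, w j • d log f_j` on `U`. -/
def omega (w : Fin (n + 1) → ℂ) : A.U → Module.Dual ℂ (Fin ℓ → ℂ) := ∑ j, w j • A.dlog j

/-- The critical locus in `U` of the multivalued master function `Φ_w = ∏ j, f_j ^ w_j`,
that is, the zero locus of `d log Φ_w`. -/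
def crit (w : Fin (n + 1) → ℂ) : Set (Fin ℓ → ℂ) := {x | ∃ h : x ∈ A.U, A.omega w ⟨x, h⟩ = 0}

/-- The product `η 0 ∧ ⋯ ∧ η (p - 1)` of one-forms on `U`. -/
def wedge {p : ℕ} (η : Fin p → A.U → Module.Dual ℂ (Fin ℓ → ℂ)) :
    A.U → ExteriorAlgebra ℂ (Module.Dual ℂ (Fin ℓ → ℂ)) := fun x =>
  ExteriorAlgebra.ιMulti ℂ p fun i => η i x

/-- The rank of a space `D` of one-forms: the largest `p` for which the multiplication map from
the `p`-th exterior power of `D` to the `p`-forms on `U` is not zero, that is, for which some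
product of `p` elements of `D` is not zero. -/
def rank (D : Submodule ℂ (A.U → Module.Dual ℂ (Fin ℓ → ℂ))) : ℕ :=
  sSup {p | ∃ η : Fin p → A.U → Module.Dual ℂ (Fin ℓ → ℂ), (∀ i, η i ∈ D) ∧ A.wedge η ≠ 0}

variable {q : ℕ} (ξ : Fin q → Fin (n + 1) → ℤ)

/-- The one-forms `ω_{ξ_1}, …, ω_{ξ_q}`. -/
def omegaFamily (i : Fin q) : A.U → Module.Dual ℂ (Fin ℓ → ℂ) := A.omega fun j => (ξ i j : ℂ)

/-- The rational space of one-forms spanned by `ω_{ξ_1}, …, ω_{ξ_q}`. -/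
def D : Submodule ℂ (A.U → Module.Dual ℂ (Fin ℓ → ℂ)) :=
  Submodule.span ℂ (Set.range (A.omegaFamily ξ))

/-- The map `(Φ_{ξ_1}, …, Φ_{ξ_q})` to `ℂ^q`, where `Φ_{ξ_i} = ∏ j, f_j ^ ξ_{ij}`. -/
def Phi (x : Fin ℓ → ℂ) : Fin q → ℂ := fun i => ∏ j, A.f j x ^ ξ i j

/-- The map `Φ_Λ = [1 : Φ_{ξ_1} : ⋯ : Φ_{ξ_q}]` to `ℙ^q`. -/
def PhiProj (x : Fin ℓ → ℂ) : ℙ ℂ (Fin (q + 1) → ℂ) :=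
  Projectivization.mk ℂ (Fin.cons 1 (A.Phi ξ x)) fun h => one_ne_zero (congrFun h 0)

end Arrangement

/-- The vector `ξ_i` for `0 ≤ i ≤ q`, with the convention `ξ_0 = 0`. -/
def xiExt {n q : ℕ} (ξ : Fin q → Fin (n + 1) → ℤ) : Fin (q + 1) → Fin (n + 1) → ℤ := Fin.cons 0 ξ

/-- The exponent vectors `ν_0, …, ν_q` obtained from `[1 : Φ_{ξ_1} : ⋯ : Φ_{ξ_q}]` by clearing
denominators and common factors: `ν_i - ν_0 = ξ_i`, and `min_i ν_{ij} = 0` for each `j`. -/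
def nu {n q : ℕ} (ξ : Fin q → Fin (n + 1) → ℤ) (i : Fin (q + 1)) (j : Fin (n + 1)) : ℤ :=
  xiExt ξ i j - Finset.univ.inf' Finset.univ_nonempty fun k => xiExt ξ k j

section Projective

variable {q : ℕ}

/-- `P` is homogeneous and vanishes on `Y ⊆ ℙ^q`. -/
def VanishesOn (Y : Set (ℙ ℂ (Fin (q + 1) → ℂ))) (P : MvPolynomial (Fin (q + 1)) ℂ) : Prop :=
  (∃ d, P.IsHomogeneous d) ∧ ∀ y ∈ Y, MvPolynomial.eval y.rep P = 0

/-- The Zariski closure of a subset of `ℙ^q`. -/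
def projClosure (Y : Set (ℙ ℂ (Fin (q + 1) → ℂ))) : Set (ℙ ℂ (Fin (q + 1) → ℂ)) :=
  {z | ∀ P, VanishesOn Y P → MvPolynomial.eval z.rep P = 0}

/-- The hyperplane `∑ j, b_j z_j = 0` of `ℙ^q`. -/
def hyperplane (b : Fin (q + 1) → ℂ) : Set (ℙ ℂ (Fin (q + 1) → ℂ)) :=
  {z | ∑ j, b j * z.rep j = 0}

/-- The rank at `y` of the Jacobian matrix of the homogeneous ideal of `V ⊆ ℙ^q`. -/
def jacobianRank (V : Set (ℙ ℂ (Fin (q + 1) → ℂ))) (y : ℙ ℂ (Fin (q + 1) → ℂ)) : ℕ :=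
  Module.finrank ℂ (Submodule.span ℂ {v : Fin (q + 1) → ℂ | ∃ P, VanishesOn V P ∧
    v = fun j => MvPolynomial.eval y.rep (MvPolynomial.pderiv j P)})

/-- The singular locus of an irreducible closed `V ⊆ ℙ^q`, by the Jacobian criterion: the points
at which the rank of the Jacobian is less than its maximum over `V`, which is `codim V`. -/
def singVariety (V : Set (ℙ ℂ (Fin (q + 1) → ℂ))) : Set (ℙ ℂ (Fin (q + 1) → ℂ)) :=
  {y ∈ V | ∃ y' ∈ V, jacobianRank V y < jacobianRank V y'}

end Projective

namespace Arrangement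

variable {ℓ n q : ℕ} (A : Arrangement ℓ n) (ξ : Fin q → Fin (n + 1) → ℤ)

/-- The closure in `ℙ^q` of the image `Y = Φ_Λ(U)`. -/
def Ybar : Set (ℙ ℂ (Fin (q + 1) → ℂ)) := projClosure (A.PhiProj ξ '' A.U)

/-- The rank at `x` of the Jacobian of `(Φ_{ξ_1}, …, Φ_{ξ_q})`. -/
def PhiRank (x : Fin ℓ → ℂ) : ℕ :=
  Module.finrank ℂ
    (LinearMap.range (fderiv ℂ (A.Phi ξ) x : (Fin ℓ → ℂ) →ₗ[ℂ] (Fin q → ℂ)))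

/-- The singular locus of `Φ_Λ`: the points of `U` at which its Jacobian does not attain its
maximal rank. -/
def singPhi : Set (Fin ℓ → ℂ) := {x ∈ A.U | ∃ x' ∈ A.U, A.PhiRank ξ x < A.PhiRank ξ x'}

/-- The set `S_Λ = Sing(Φ_Λ) ∪ Φ_Λ⁻¹(Sing(Ȳ))` in `U`. -/
def S : Set (Fin ℓ → ℂ) := A.singPhi ξ ∪ {x ∈ A.U | A.PhiProj ξ x ∈ singVariety (A.Ybar ξ)}

end Arrangement

/-- The Zariski topology on `ℂ^ℓ`, with the sets `P ≠ 0` as a basis. -/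
@[reducible] def zariski (ℓ : ℕ) : TopologicalSpace (Fin ℓ → ℂ) :=
  TopologicalSpace.generateFrom
    (Set.range fun P : MvPolynomial (Fin ℓ) ℂ => {x | MvPolynomial.eval x P ≠ 0})

/-- `Z` is an irreducible component of `C ⊆ ℂ^ℓ`, that is, a maximal irreducible subset of `C`, in
the Zariski topology. -/
def IsComponent {ℓ : ℕ} (C Z : Set (Fin ℓ → ℂ)) : Prop :=
  Maximal (fun T => T ⊆ C ∧ @IsIrreducible _ (zariski ℓ) T) Z

/-- The codimension of an irreducible `Z ⊆ ℂ^ℓ`: the height of the prime ideal of `Z`. -/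
def codim {ℓ : ℕ} (Z : Set (Fin ℓ → ℂ)) : ℕ∞ := (MvPolynomial.vanishingIdeal ℂ Z).height

/-- `p` holds for generic `a ∈ ℂ^(q+1)` with `∑ i, a_i = 0`: it holds on a nonempty
Zariski-open subset of this linear space. -/
def ForGenericWeights {q : ℕ} (p : (Fin (q + 1) → ℂ) → Prop) : Prop :=
  ∃ G : MvPolynomial (Fin (q + 1)) ℂ,
    (∃ a : Fin (q + 1) → ℂ, ∑ i, a i = 0 ∧ MvPolynomial.eval a G ≠ 0) ∧
    ∀ a : Fin (q + 1) → ℂ, ∑ i, a i = 0 → MvPolynomial.eval a G ≠ 0 → p a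

end CritLocus

end

/-! Put `k = q - 1` and let Y_i = Φ_{ξ_i}, with Y_0 = 1. Since Ȳ is the hyperplane Σ b_j z_j = 0,
the Y_i satisfy Σ b_i Y_i = 0, while Y_1, …, Y_k are algebraically independent
(`algebraicIndependent_Y`). In characteristic zero their differentials are then independent at some
point (`exists_linearIndependent_dAt`), so D has rank `k` (`rank_D`). A hyperplane being smooth, the
complement of S_Λ in U is exactly the locus where these `k` differentials are independent
(`notMem_S_iff`).

Because Σ a_i = 0, the form ω_λ equals Σ a_i dY_i / Y_i. Off S_Λ the only relation among the dY_i,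
up to scalars, is Σ b_i dY_i = 0; hence ω_λ vanishes exactly when the a_i / Y_i are proportional to
the b_i, that is, when Φ_Λ(x) = [a_0/b_0 : ⋯ : a_q/b_q] (`mem_crit_iff`). Thus crit(Φ_λ) - S_Λ is a
fibre of Φ_Λ off S_Λ.

Dominance and Chevalley's theorem make this fibre nonempty for generic weights
(`exists_point_of_eval_ne_zero`). It is cut out by `k` equations with independent gradients, so
Krull's height theorem and a Jacobian criterion give codimension `k` (`codim_eq_of_isComponent`). -/

noncomputable section

namespace CritLocus

/-! ### Lower bounds for heights from derivations -/

section Height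

variable {K R : Type*} [Field K] [CharZero K] [CommRing R] [Algebra K R]

/-- After localizing at a minimal prime of `I`, the radical of `I` is the maximal ideal; clearing
denominators gives `s`. -/
theorem _root_.Ideal.exists_mul_pow_mem_of_mem_minimalPrimes {I p : Ideal R} (hp : p ∈ I.minimalPrimes)
    {g : R} (hg : g ∈ p) : ∃ s ∉ p, ∃ N : ℕ, s * g ^ N ∈ I := by
  have hpp : p.IsPrime := hp.1.1
  have h := IsLocalization.AtPrime.radical_map_of_mem_minimalPrimes (Localization.AtPrime p) p I hp
  have hg' : algebraMap R (Localization.AtPrime p) g ∈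
      (I.map (algebraMap R (Localization.AtPrime p))).radical := by
    rw [h]; exact Ideal.mem_map_of_mem _ hg
  obtain ⟨N, hN⟩ := hg'
  rw [← map_pow, IsLocalization.algebraMap_mem_map_algebraMap_iff p.primeCompl] at hN
  obtain ⟨s, hs, hN⟩ := hN
  exact ⟨s, hs, N, hN⟩

/-- If a derivation preserves `I` and maps `g` to an element outside the minimal prime `p` of `I`, then
`g ∉ p`. -/
theorem notMem_minimalPrime_of_derivation {I p : Ideal R} (hp : p ∈ I.minimalPrimes)
    (E : Derivation K R R) (hE : ∀ x ∈ I, E x ∈ I) {g : R} (hg : E g ∉ p) : g ∉ p := by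
  have hpp : p.IsPrime := hp.1.1
  -- Descent on the exponent, with `s` left free because each differentiation replaces it by `s * s
  -- * E g`.
  have key : ∀ N : ℕ, ∀ s ∉ p, s * g ^ N ∉ I := by
    intro N
    induction N with
    | zero => intro s hs h; exact hs (hp.1.2 (by simpa using h))
    | succ N ih =>
      intro s hs h
      have h1 : E (s * g ^ (N + 1)) ∈ I := hE _ h
      refine ih (s * s * E g) (fun hm => ?_) ?_
      · rcases hpp.mem_or_mem hm with hm | hm
        · rcases hpp.mem_or_mem hm with hm | hm <;> exact hs hm
        · exact hg hm
      -- The subtraction cancels the term with `E s`; what remains is `N + 1` times the desired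
      -- element, and `N + 1` is invertible in `K`.
      · have h2 : s * E (s * g ^ (N + 1)) - E s * (s * g ^ (N + 1)) ∈ I :=
          I.sub_mem (I.mul_mem_left _ h1) (I.mul_mem_left _ h)
        have h3 : s * E (s * g ^ (N + 1)) - E s * (s * g ^ (N + 1)) =
            algebraMap K R ((N : K) + 1) * (s * s * E g * g ^ N) := by
          rw [E.leibniz, E.leibniz_pow]
          simp only [smul_eq_mul, nsmul_eq_mul, map_add, map_natCast, map_one, Nat.add_sub_cancel]
          push_cast
          ring
        rw [h3] at h2
        have h4 := I.mul_mem_left (algebraMap K R ((N : K) + 1)⁻¹) h2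
        rwa [← mul_assoc, ← map_mul, inv_mul_cancel₀ (Nat.cast_add_one_ne_zero N), map_one, one_mul] at h4
  intro hgp
  obtain ⟨s, hs, N, hN⟩ := Ideal.exists_mul_pow_mem_of_mem_minimalPrimes hp hgp
  exact key N s hs hN

/-- A Jacobian criterion: if `g₁, …, gₖ` lie in a prime `p` and there are derivations dual to them up
to a factor outside `p`, then `p` has height at least `k`. -/
theorem le_height_of_dual_derivations {k : ℕ} (g : Fin k → R) (E : Fin k → Derivation K R R) (Δ : R)
    (hE : ∀ i j, E i (g j) = if i = j then Δ else 0) (p : Ideal R) [hp : p.IsPrime] (hΔ : Δ ∉ p)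
    (hg : ∀ i, g i ∈ p) : (k : ℕ∞) ≤ p.height := by
  induction k generalizing p with
  | zero => simp
  | succ k ih =>
    have hI : Ideal.span (Set.range fun i : Fin k => g i.castSucc) ≤ p := by
      rw [Ideal.span_le]; rintro _ ⟨i, rfl⟩; exact hg _
    obtain ⟨p', hp', hle⟩ := Ideal.exists_minimalPrimes_le hI
    have hpp : p'.IsPrime := hp'.1.1
    have h1 : (k : ℕ∞) ≤ p'.height := by
      refine ih (fun i => g i.castSucc) (fun i => E i.castSucc) ?_ p' (fun h => hΔ (hle h)) ?_
      · intro i j; simp [hE]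
      · intro i; exact hp'.1.2 (Ideal.subset_span ⟨i, rfl⟩)
    -- The last derivation kills the earlier `g i`, hence preserves their ideal, but sends the last
    -- one to `Δ ∉ p'`; so the inclusion `p' ≤ p` is strict.
    have h2 : g (Fin.last k) ∉ p' := by
      refine notMem_minimalPrime_of_derivation hp' (E (Fin.last k)) ?_ ?_
      · intro x hx
        induction hx using Submodule.span_induction with
        | mem x hx =>
          obtain ⟨i, rfl⟩ := hx
          rw [hE, if_neg (Fin.castSucc_lt_last i).ne']; exact zero_mem _
        | zero => rw [map_zero]; exact zero_mem _
        | add x y _ _ hx hy => rw [map_add]; exact add_mem hx hy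
        | smul a x hx hx' =>
          rw [smul_eq_mul, Derivation.leibniz]
          exact add_mem (Ideal.mul_mem_left _ _ hx') (Ideal.mul_mem_right _ _ hx)
      · rw [hE, if_pos rfl]; exact fun h => hΔ (hle h)
    have h3 : p' < p := lt_of_le_of_ne hle fun h => h2 (h ▸ hg _)
    calc ((k + 1 : ℕ) : ℕ∞) = (k : ℕ∞) + 1 := by push_cast; rfl
      _ ≤ p'.height + 1 := by gcongr
      _ ≤ p.height := Ideal.height_add_one_le_of_lt_of_isPrime h3

end Height

theorem derivation_sum_apply {K R ι : Type*} [CommRing K] [CommRing R] [Algebra K R] (s : Finset ι)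
    (D : ι → Derivation K R R) (x : R) : (∑ i ∈ s, D i) x = ∑ i ∈ s, D i x := by
  rw [← Derivation.coeFnAddMonoidHom_apply, map_sum, Finset.sum_apply]
  rfl

/-! ### Irreducible components in the Zariski topology and their codimension -/

section Zariski

open MvPolynomial Topology

variable {ℓ : ℕ}

theorem isTopologicalBasis_zariski : @TopologicalSpace.IsTopologicalBasis _ (zariski ℓ)
    (Set.range fun P : MvPolynomial (Fin ℓ) ℂ => {x | eval x P ≠ 0}) := by
  let := zariski ℓ
  refine ⟨?_, ?_, rfl⟩
  · rintro _ ⟨P, rfl⟩ _ ⟨Q, rfl⟩ x ⟨hP, hQ⟩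
    refine ⟨_, ⟨P * Q, rfl⟩, ?_, ?_⟩
    · simpa using ⟨hP, hQ⟩
    · intro y hy
      simpa using hy
  · refine Set.eq_univ_of_forall fun x => ?_
    exact ⟨_, ⟨1, rfl⟩, by simp⟩

theorem isOpen_basic (P : MvPolynomial (Fin ℓ) ℂ) : IsOpen[zariski ℓ] {x | eval x P ≠ 0} :=
  TopologicalSpace.isOpen_generateFrom_of_mem ⟨P, rfl⟩

theorem vanishingIdeal_isPrime {Z : Set (Fin ℓ → ℂ)} (hZ : @IsIrreducible _ (zariski ℓ) Z) :
    (vanishingIdeal ℂ Z).IsPrime := by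
  let := zariski ℓ
  refine ⟨?_, ?_⟩
  · obtain ⟨x, hx⟩ := hZ.1
    intro h
    have : (1 : MvPolynomial (Fin ℓ) ℂ) ∈ vanishingIdeal ℂ Z := h ▸ Submodule.mem_top
    simpa using this x hx
  · intro P Q hPQ
    by_contra! hcon
    simp only [mem_vanishingIdeal_iff, not_forall] at hcon
    obtain ⟨⟨x, hx, hPx⟩, ⟨y, hy, hQy⟩⟩ := hcon
    obtain ⟨z, hz, hz1, hz2⟩ := hZ.2 _ _ (isOpen_basic P) (isOpen_basic Q) ⟨x, hx, by simpa using hPx⟩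
      ⟨y, hy, by simpa using hQy⟩
    have := hPQ z hz
    rw [map_mul] at this
    rcases mul_eq_zero.1 this with h | h
    · exact hz1 (by simpa using h)
    · exact hz2 (by simpa using h)

theorem exists_mem_zeroLocus_of_notMem (p : Ideal (MvPolynomial (Fin ℓ) ℂ)) [p.IsPrime]
    {P : MvPolynomial (Fin ℓ) ℂ} (hP : P ∉ p) : ∃ z ∈ zeroLocus ℂ p, eval z P ≠ 0 := by
  by_contra! h
  apply hP
  rw [← IsPrime.vanishingIdeal_zeroLocus (K := ℂ) p]
  intro z hz
  simpa using h z hz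

/-- Basic open sets meeting the locus come from polynomials outside `p`. Their product is outside
`p` too, so by the Nullstellensatz it is nonzero at some zero of `p`. -/
theorem isIrreducible_zeroLocus_inter (p : Ideal (MvPolynomial (Fin ℓ) ℂ)) [p.IsPrime]
    {O : Set (Fin ℓ → ℂ)} (hO : IsOpen[zariski ℓ] O) (hne : (zeroLocus ℂ p ∩ O).Nonempty) :
    @IsIrreducible _ (zariski ℓ) (zeroLocus ℂ p ∩ O) := by
  let := zariski ℓ
  refine ⟨hne, ?_⟩
  rintro u v hu hv ⟨x, ⟨hxp, hxO⟩, hxu⟩ ⟨y, ⟨hyp, hyO⟩, hyv⟩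
  obtain ⟨_, ⟨P, rfl⟩, hPx, hP⟩ := isTopologicalBasis_zariski.exists_subset_of_mem_open
    (show x ∈ O ∩ u from ⟨hxO, hxu⟩) (hO.inter hu)
  obtain ⟨_, ⟨Q, rfl⟩, hQy, hQ⟩ := isTopologicalBasis_zariski.exists_subset_of_mem_open hyv hv
  have hPp : P ∉ p := fun h => hPx (by simpa using hxp P h)
  have hQp : Q ∉ p := fun h => hQy (by simpa using hyp Q h)
  obtain ⟨z, hz, hzPQ⟩ := exists_mem_zeroLocus_of_notMem p
    (fun h => (Ideal.IsPrime.mem_or_mem ‹_› h).elim hPp hQp : P * Q ∉ p)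
  rw [map_mul, mul_ne_zero_iff] at hzPQ
  exact ⟨z, ⟨hz, (hP hzPQ.1).1⟩, (hP hzPQ.1).2, hQ hzPQ.2⟩

/-- A nonempty open piece of an irreducible locus is dense, so it has the same ideal. -/
theorem vanishingIdeal_zeroLocus_inter (p : Ideal (MvPolynomial (Fin ℓ) ℂ)) [p.IsPrime]
    {O : Set (Fin ℓ → ℂ)} (hO : IsOpen[zariski ℓ] O) (hne : (zeroLocus ℂ p ∩ O).Nonempty) :
    vanishingIdeal ℂ (zeroLocus ℂ p ∩ O) = p := by
  let := zariski ℓ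
  refine le_antisymm ?_ ?_
  · intro F hF
    by_contra hFp
    obtain ⟨x, hxp, hxO⟩ := hne
    obtain ⟨_, ⟨P, rfl⟩, hPx, hP⟩ := isTopologicalBasis_zariski.exists_subset_of_mem_open hxO hO
    have hPp : P ∉ p := fun h => hPx (by simpa using hxp P h)
    obtain ⟨z, hz, hzPF⟩ := exists_mem_zeroLocus_of_notMem p
      (fun h => (Ideal.IsPrime.mem_or_mem ‹_› h).elim hPp hFp : P * F ∉ p)
    rw [map_mul, mul_ne_zero_iff] at hzPF
    exact hzPF.2 (by simpa using hF z ⟨hz, hP hzPF.1⟩)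
  · intro F hF x hx
    exact hx.1 F hF

/-- The derivation `∑ i, v i • ∂/∂x_i`. -/
def dirDeriv (v : Fin ℓ → ℂ) : Derivation ℂ (MvPolynomial (Fin ℓ) ℂ) (MvPolynomial (Fin ℓ) ℂ) :=
  ∑ i, v i • pderiv i

theorem dirDeriv_apply (v : Fin ℓ → ℂ) (P : MvPolynomial (Fin ℓ) ℂ) :
    dirDeriv v P = ∑ i, v i • pderiv i P := by
  simp [dirDeriv, derivation_sum_apply]

/-- The components of the part of the zero locus of `g₁, …, gₖ` in a Zariski-open set have codimension
`k` if the gradients of the `gᵢ` are linearly independent there. -/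
theorem codim_eq_of_isComponent {k : ℕ} (g : Fin k → MvPolynomial (Fin ℓ) ℂ) {O : Set (Fin ℓ → ℂ)}
    (hO : IsOpen[zariski ℓ] O)
    (hg : ∀ x ∈ O, (∀ i, eval x (g i) = 0) →
      ∃ v : Fin k → Fin ℓ → ℂ, ∀ i j, eval x (dirDeriv (v i) (g j)) = if i = j then 1 else 0)
    {Z : Set (Fin ℓ → ℂ)} (hZ : IsComponent {x ∈ O | ∀ i, eval x (g i) = 0} Z) : codim Z = k := by
  obtain ⟨⟨hZW, hZirr⟩, hmax⟩ := hZ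
  have hprime := vanishingIdeal_isPrime hZirr
  obtain ⟨x, hxZ⟩ := hZirr.1
  have hgZ : ∀ i, g i ∈ vanishingIdeal ℂ Z := fun i y hy => by simpa using (hZW hy).2 i
  refine le_antisymm ?_ ?_
  -- A prime between the equations and the ideal of `Z` cuts out in `O` an irreducible set
  -- containing `Z`, hence equal to `Z` by maximality. Krull's height theorem then applies.
  · have hmin : vanishingIdeal ℂ Z ∈ (Ideal.span (Set.range g)).minimalPrimes := by
      refine ⟨⟨hprime, ?_⟩, ?_⟩
      · rw [Ideal.span_le]; rintro _ ⟨i, rfl⟩; exact hgZ i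
      · rintro p ⟨hp, hIp⟩ hpZ
        have hsub : Z ⊆ zeroLocus ℂ p ∩ O := fun y hy => ⟨fun F hF => hpZ hF y hy, (hZW hy).1⟩
        have hne : (zeroLocus ℂ p ∩ O).Nonempty := ⟨x, hsub hxZ⟩
        have hle : zeroLocus ℂ p ∩ O ⊆ Z := by
          refine hmax ⟨?_, isIrreducible_zeroLocus_inter p hO hne⟩ hsub
          rintro y ⟨hyp, hyO⟩
          exact ⟨hyO, fun i => by simpa using hyp (g i) (hIp (Ideal.subset_span ⟨i, rfl⟩))⟩
        calc vanishingIdeal ℂ Z ≤ vanishingIdeal ℂ (zeroLocus ℂ p ∩ O) :=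
              vanishingIdeal_anti_mono hle
          _ = p := vanishingIdeal_zeroLocus_inter p hO hne
    refine (Ideal.height_le_card_of_mem_minimalPrimes_span (Set.finite_range g) hmin).trans ?_
    have : (Set.range g).ncard ≤ k := by
      rw [← Set.image_univ]
      refine (Set.ncard_image_le Set.finite_univ).trans ?_
      simp [Set.ncard_univ]
    exact_mod_cast this
  · obtain ⟨v, hv⟩ := hg x (hZW hxZ).1 (hZW hxZ).2
    -- The `v i` are dual to the gradients at `x` only; the adjugate of `M` turns them into
    -- derivations dual everywhere up to the factor `M.det`, which is `1` at `x`.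
    let M : Matrix (Fin k) (Fin k) (MvPolynomial (Fin ℓ) ℂ) :=
      Matrix.of fun i j => dirDeriv (v i) (g j)
    have hM : (eval x).mapMatrix M = 1 := by
      ext i j
      simp [M, hv, Matrix.one_apply]
    refine le_height_of_dual_derivations (K := ℂ) g
      (fun i => ∑ l, M.adjugate i l • dirDeriv (v l)) M.det ?_ _ ?_ hgZ
    · intro i j
      have := congrFun (congrFun M.adjugate_mul i) j
      simp only [Matrix.mul_apply, Matrix.smul_apply, Matrix.one_apply, smul_eq_mul, mul_ite, mul_one,
        mul_zero] at this
      rw [← this]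
      simp [derivation_sum_apply, M]
    · intro h
      have h1 : eval x M.det = 0 := by simpa using h x hxZ
      rw [RingHom.map_det, hM, Matrix.det_one] at h1
      exact one_ne_zero h1

end Zariski

/-! ### Differentials of regular functions on `h ≠ 0` through dual numbers -/

section Germ

open MvPolynomial TrivSqZeroExt

variable {ℓ : ℕ}

/-- Evaluation at the point `x + ε v` over the dual numbers. -/
def dualEval {σ : Type*} (x v : σ → ℂ) : MvPolynomial σ ℂ →ₐ[ℂ] DualNumber ℂ :=
  aeval fun i => inl (x i) + inr (v i)

theorem fst_dualEval {σ : Type*} (x v : σ → ℂ) (P : MvPolynomial σ ℂ) :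
    (dualEval x v P).fst = eval x P := by
  have : (fstHom ℂ ℂ ℂ).comp (dualEval x v) = aeval x := by
    ext i; simp [dualEval]
  simpa using DFunLike.congr_fun this P

theorem snd_dualEval {σ : Type*} [Fintype σ] (x v : σ → ℂ) (P : MvPolynomial σ ℂ) :
    (dualEval x v P).snd = ∑ i, v i * eval x (pderiv i P) := by
  classical
  induction P using MvPolynomial.induction_on with
  | C a => simp [dualEval, TrivSqZeroExt.algebraMap_eq_inl']
  | add P Q hP hQ => simp [hP, hQ, mul_add, Finset.sum_add_distrib]
  | mul_X P i hP =>
    have h1 : (dualEval x v (X i)) = inl (x i) + inr (v i) := by simp [dualEval]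
    rw [map_mul, TrivSqZeroExt.snd_mul, hP, fst_dualEval, h1]
    simp only [fst_add, fst_inl, fst_inr, snd_add, snd_inl, snd_inr, Derivation.leibniz, pderiv_X,
      map_add, smul_eq_mul, map_mul, eval_X, mul_add, Finset.sum_add_distrib, add_zero, zero_add,
      op_smul_eq_smul, smul_eq_mul, Pi.single_apply]
    congr 1
    · rw [Finset.sum_eq_single i]
      · simp; ring
      · intro j _ hj; simp [hj.symm]
      · simp
    · rw [Finset.mul_sum]
      exact Finset.sum_congr rfl fun j _ => by ring

variable {h : MvPolynomial (Fin ℓ) ℂ} {x : Fin ℓ → ℂ}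

/-- Evaluation of regular functions on `h ≠ 0` at the point `x + ε v` over the dual numbers. -/
def germ (hx : eval x h ≠ 0) (v : Fin ℓ → ℂ) : Localization.Away h →ₐ[ℂ] DualNumber ℂ :=
  IsLocalization.liftAlgHom (M := Submonoid.powers h) (f := dualEval x v) <| by
    rintro ⟨_, n, rfl⟩
    rw [TrivSqZeroExt.isUnit_iff_isUnit_fst, fst_dualEval]
    simpa using fun h0 => absurd h0 hx

/-- Evaluation of regular functions on `h ≠ 0` at the point `x`. -/
def evAt (hx : eval x h ≠ 0) : Localization.Away h →ₐ[ℂ] ℂ :=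
  (fstHom ℂ ℂ ℂ).comp (germ hx 0)

@[simp] theorem germ_algebraMap (hx : eval x h ≠ 0) (v : Fin ℓ → ℂ) (P : MvPolynomial (Fin ℓ) ℂ) :
    germ hx v (algebraMap _ _ P) = dualEval x v P := by
  simp [germ]

@[simp] theorem evAt_algebraMap (hx : eval x h ≠ 0) (P : MvPolynomial (Fin ℓ) ℂ) :
    evAt hx (algebraMap _ _ P) = eval x P := by
  simp [evAt, fst_dualEval]

theorem fst_germ (hx : eval x h ≠ 0) (v : Fin ℓ → ℂ) (b : Localization.Away h) :
    (germ hx v b).fst = evAt hx b := by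
  have : (fstHom ℂ ℂ ℂ).comp (germ hx v) = evAt hx := by
    refine IsLocalization.algHom_ext (Submonoid.powers h) ?_
    ext i
    change (germ hx v (algebraMap _ _ (X i))).fst = evAt hx (algebraMap _ _ (X i))
    simp [fst_dualEval]
  exact DFunLike.congr_fun this b

theorem exists_numerator (b : Localization.Away h) : ∃ (n : ℕ) (P : MvPolynomial (Fin ℓ) ℂ),
    b * algebraMap _ _ h ^ n = algebraMap _ _ P :=
  IsLocalization.Away.surj h b

theorem evAt_numerator (hx : eval x h ≠ 0) {b : Localization.Away h} {n : ℕ}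
    {P : MvPolynomial (Fin ℓ) ℂ} (hP : b * algebraMap _ _ h ^ n = algebraMap _ _ P) :
    evAt hx b * eval x h ^ n = eval x P := by
  simpa using congrArg (evAt hx) hP

/-- Obtained by differentiating `b * h ^ n = P`. It makes linearity in `v` visible, which is not
evident when each `v` defines its own algebra homomorphism. -/
theorem snd_germ_numerator (hx : eval x h ≠ 0) (v : Fin ℓ → ℂ) {b : Localization.Away h} {n : ℕ}
    {P : MvPolynomial (Fin ℓ) ℂ} (hP : b * algebraMap _ _ h ^ n = algebraMap _ _ P) :
    (germ hx v b).snd * eval x h ^ n =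
      ∑ i, v i * (eval x (pderiv i P) - evAt hx b * eval x (pderiv i (h ^ n))) := by
  have h1 := congrArg (fun z => (germ hx v z).snd) hP
  simp only [map_mul, TrivSqZeroExt.snd_mul, ← map_pow, germ_algebraMap, fst_germ, fst_dualEval,
    snd_dualEval, op_smul_eq_smul, smul_eq_mul] at h1
  simp only [mul_sub, Finset.sum_sub_distrib, ← h1, Finset.mul_sum, map_pow]
  have : ∀ i, evAt hx b * (v i * eval x (pderiv i (h ^ n))) =
    v i * (evAt hx b * eval x (pderiv i (h ^ n))) := fun i => by ring
  simp only [this]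
  ring

/-- The differential at `x` of a regular function on `h ≠ 0`. -/
def dAt (hx : eval x h ≠ 0) (b : Localization.Away h) : Module.Dual ℂ (Fin ℓ → ℂ) where
  toFun v := (germ hx v b).snd
  map_add' v w := by
    obtain ⟨n, P, hP⟩ := exists_numerator b
    refine mul_right_cancel₀ (pow_ne_zero n hx) ?_
    simp only [add_mul, snd_germ_numerator hx _ hP, Pi.add_apply, Finset.sum_add_distrib]
  map_smul' c v := by
    obtain ⟨n, P, hP⟩ := exists_numerator b
    refine mul_right_cancel₀ (pow_ne_zero n hx) ?_
    simp only [smul_eq_mul, mul_assoc, snd_germ_numerator hx _ hP, Pi.smul_apply, Finset.mul_sum,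
      RingHom.id_apply]

theorem dAt_apply (hx : eval x h ≠ 0) (b : Localization.Away h) (v : Fin ℓ → ℂ) :
    dAt hx b v = (germ hx v b).snd := rfl

theorem dAt_add (hx : eval x h ≠ 0) (b c : Localization.Away h) :
    dAt hx (b + c) = dAt hx b + dAt hx c := by
  ext; simp [dAt_apply]

theorem dAt_sum (hx : eval x h ≠ 0) {ι : Type*} (s : Finset ι) (b : ι → Localization.Away h) :
    dAt hx (∑ i ∈ s, b i) = ∑ i ∈ s, dAt hx (b i) := by
  classical
  induction s using Finset.induction_on with
  | empty => ext; simp [dAt_apply]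
  | insert a s ha ih => rw [Finset.sum_insert ha, dAt_add, ih, Finset.sum_insert ha]

theorem dAt_mul (hx : eval x h ≠ 0) (b c : Localization.Away h) :
    dAt hx (b * c) = evAt hx b • dAt hx c + evAt hx c • dAt hx b := by
  ext
  simp [dAt_apply, fst_germ, mul_comm]

theorem dAt_smul (hx : eval x h ≠ 0) (r : ℂ) (b : Localization.Away h) :
    dAt hx (r • b) = r • dAt hx b := by
  ext; simp [dAt_apply]

theorem dAt_algebraMap (hx : eval x h ≠ 0) (r : ℂ) :
    dAt hx (algebraMap ℂ (Localization.Away h) r) = 0 := by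
  ext; simp [dAt_apply, TrivSqZeroExt.algebraMap_eq_inl']

theorem dAt_algebraMap_apply (hx : eval x h ≠ 0) (P : MvPolynomial (Fin ℓ) ℂ) (v : Fin ℓ → ℂ) :
    dAt hx (algebraMap _ _ P) v = eval x (dirDeriv v P) := by
  simp [dAt_apply, snd_dualEval, dirDeriv_apply, MvPolynomial.smul_eval]

theorem dAt_X (hx : eval x h ≠ 0) (i : Fin ℓ) (v : Fin ℓ → ℂ) :
    dAt hx (algebraMap (MvPolynomial (Fin ℓ) ℂ) _ (X i)) v = v i := by
  simp [dAt_apply, dualEval]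

/-- The derivative of `b` along a fixed vector is given by a polynomial, up to a power of `h`. -/
theorem exists_eval_eq_pow_mul_dAt (b : Localization.Away h) :
    ∃ m : ℕ, ∀ v : Fin ℓ → ℂ, ∃ N : MvPolynomial (Fin ℓ) ℂ, ∀ (y : Fin ℓ → ℂ) (hy : eval y h ≠ 0),
      eval y N = eval y h ^ m * dAt hy b v := by
  obtain ⟨n, P, hP⟩ := exists_numerator b
  -- The quotient rule for `P / h ^ n`.
  refine ⟨n + n, fun v => ⟨h ^ n * dirDeriv v P - P * dirDeriv v (h ^ n), fun y hy => ?_⟩⟩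
  have h1 := congrArg (fun z => dAt hy z v) hP
  simp only [dAt_mul, ← map_pow, dAt_algebraMap_apply, LinearMap.add_apply, LinearMap.smul_apply,
    smul_eq_mul, evAt_algebraMap] at h1
  have h2 := evAt_numerator hy hP
  simp only [map_sub, map_mul, ← h1, ← h2, map_pow]
  ring

theorem exists_eval_ne_zero_of_ne_zero [hh : Fact (h ≠ 0)] {b : Localization.Away h} (hb : b ≠ 0) :
    ∃ (y : Fin ℓ → ℂ) (hy : eval y h ≠ 0), evAt hy b ≠ 0 := by
  obtain ⟨n, P, hP⟩ := exists_numerator b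
  have hu : IsUnit (algebraMap (MvPolynomial (Fin ℓ) ℂ) (Localization.Away h) h) :=
    IsLocalization.Away.algebraMap_isUnit h
  have hP0 : P ≠ 0 := by
    rintro rfl
    rw [map_zero] at hP
    exact hb ((hu.pow n).mul_left_eq_zero.1 hP)
  have : P * h ≠ 0 := mul_ne_zero hP0 hh.out
  obtain ⟨y, hy⟩ : ∃ y, eval y (P * h) ≠ 0 := by
    by_contra! hcon
    exact this (MvPolynomial.funext fun y => by simpa using hcon y)
  rw [map_mul, mul_ne_zero_iff] at hy
  refine ⟨y, hy.2, fun h0 => hy.1 ?_⟩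
  rw [← evAt_numerator hy.2 hP, h0, zero_mul]

theorem eq_zero_of_forall_evAt [Fact (h ≠ 0)] {b : Localization.Away h}
    (hb : ∀ (y : Fin ℓ → ℂ) (hy : eval y h ≠ 0), evAt hy b = 0) : b = 0 := by
  by_contra hne
  obtain ⟨y, hy, h0⟩ := exists_eval_ne_zero_of_ne_zero hne
  exact h0 (hb y hy)

instance [hh : Fact (h ≠ 0)] : IsDomain (Localization.Away h) :=
  IsLocalization.isDomain_localization (powers_le_nonZeroDivisors_of_noZeroDivisors hh.out)

end Germ

/-! ### Algebraic independence and generic independence of differentials -/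

section GenericRank

open MvPolynomial

/-- An element which is algebraic over a domain of characteristic zero is a simple root of some
polynomial. -/
theorem exists_aeval_derivative_ne_zero {S B : Type*} [CommRing S] [CommRing B] [Algebra S B]
    [IsDomain S] [CharZero S] [FaithfulSMul S B] {b : B} (hb : IsAlgebraic S b) :
    ∃ G : Polynomial S, Polynomial.aeval b G = 0 ∧ Polynomial.aeval b G.derivative ≠ 0 := by
  obtain ⟨G, hG, hGb⟩ := hb
  induction hn : G.natDegree using Nat.strong_induction_on generalizing G with
  | _ n ih =>
    by_cases hd : Polynomial.aeval b G.derivative = 0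
    · have hdeg : G.natDegree ≠ 0 := by
        intro h0
        rw [Polynomial.eq_C_of_natDegree_eq_zero h0] at hGb hG
        simp only [Polynomial.aeval_C, FaithfulSMul.algebraMap_eq_zero_iff] at hGb
        exact hG (by rw [hGb, Polynomial.C_0])
      have hne : G.derivative ≠ 0 := fun h0 => hdeg (Polynomial.derivative_eq_zero.1 h0)
      exact ih _ (hn ▸ Polynomial.natDegree_derivative_lt hdeg) G.derivative hne hd rfl
    · exact ⟨G, hGb, hd⟩

variable {ℓ : ℕ} {h : MvPolynomial (Fin ℓ) ℂ} {x : Fin ℓ → ℂ}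

/-- The coefficients are constant along `v`, so only the chain-rule term survives. If `b` is a
simple root of `G` at `x`, its derivative along `v` must vanish. -/
theorem dAt_aeval_polynomial (hx : eval x h ≠ 0) (v : Fin ℓ → ℂ)
    (S : Subalgebra ℂ (Localization.Away h)) (hS : ∀ s ∈ S, dAt hx s v = 0) (b : Localization.Away h)
    (G : Polynomial S) : dAt hx (Polynomial.aeval b G) v =
      evAt hx (Polynomial.aeval b G.derivative) * dAt hx b v := by
  induction G using Polynomial.induction_on' with
  | add p q hp hq => simp [dAt_add, hp, hq, add_mul]
  | monomial n a =>
    have hpow : ∀ n : ℕ, dAt hx (b ^ n) v = n * evAt hx b ^ (n - 1) * dAt hx b v := by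
      have h1 : dAt hx 1 v = 0 := by simpa using DFunLike.congr_fun (dAt_algebraMap hx 1) v
      intro n
      induction n with
      | zero => simp [h1]
      | succ n ih =>
        rw [pow_succ, dAt_mul, LinearMap.add_apply, LinearMap.smul_apply, LinearMap.smul_apply, ih]
        rcases n with _ | n
        · simp
        · simp only [smul_eq_mul, map_pow, Nat.add_sub_cancel]
          push_cast; ring
    have ha : dAt hx (algebraMap S (Localization.Away h) a) v = 0 := hS _ a.2
    rw [Polynomial.aeval_monomial, dAt_mul, Polynomial.derivative_monomial, Polynomial.aeval_monomial]
    simp only [LinearMap.add_apply, LinearMap.smul_apply, ha, hpow, smul_eq_mul, map_mul, map_pow,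
      map_natCast]
    ring

/-- The differentials of algebraically independent functions are generically linearly independent. -/
theorem exists_linearIndependent_dAt [hh : Fact (h ≠ 0)] {k : ℕ} {Y : Fin k → Localization.Away h}
    (hY : AlgebraicIndependent ℂ Y) :
    ∃ (y : Fin ℓ → ℂ) (hy : eval y h ≠ 0), LinearIndependent ℂ fun i => dAt hy (Y i) := by
  classical
  let B := Localization.Away h
  let Xs : Fin ℓ → B := fun i => algebraMap (MvPolynomial (Fin ℓ) ℂ) _ (X i)
  let t : Set B := Set.range Y ∪ Set.range Xs
  have hinjR : Function.Injective (algebraMap (MvPolynomial (Fin ℓ) ℂ) B) :=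
    IsLocalization.injective B (powers_le_nonZeroDivisors_of_noZeroDivisors hh.out)
  have hXtb : IsTranscendenceBasis ℂ Xs := by
    have hal : Algebra.IsAlgebraic (MvPolynomial (Fin ℓ) ℂ) B :=
      IsLocalization.isAlgebraic B (Submonoid.powers h)
    have : FaithfulSMul (MvPolynomial (Fin ℓ) ℂ) B := (faithfulSMul_iff_algebraMap_injective _ _).2 hinjR
    exact IsTranscendenceBasis.algebraMap_comp (A := B) (IsTranscendenceBasis.mvPolynomial (Fin ℓ) ℂ)
  have halt : Algebra.IsAlgebraic (Algebra.adjoin ℂ t) B := by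
    have := hXtb.isAlgebraic
    have hle : Algebra.adjoin ℂ (Set.range Xs) ≤ Algebra.adjoin ℂ t :=
      Algebra.adjoin_mono Set.subset_union_right
    exact ⟨fun b => (this.isAlgebraic b).tower_top_of_subalgebra_le hle⟩
  -- Extending `Y` by coordinates to a transcendence basis gives exactly `ℓ` functions, so the map
  -- `T` below is square.
  obtain ⟨u, hYu, hut, hu⟩ := exists_isTranscendenceBasis_between (R := ℂ) (Set.range Y) t
    Set.subset_union_left (AlgebraicIndependent.to_subtype_range hY)
  have hufin : u.Finite := ((Set.finite_range Y).union (Set.finite_range Xs)).subset hut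
  have : Fintype u := hufin.fintype
  have hcard : Fintype.card u = ℓ := by
    have h1 := hu.lift_cardinalMk_eq hXtb
    simpa using h1
  let S := Algebra.adjoin ℂ u
  have halg : Algebra.IsAlgebraic S B := by
    have := hu.isAlgebraic
    rwa [Subtype.range_coe] at this
  have : CharZero S := charZero_of_injective_algebraMap (algebraMap ℂ S).injective
  choose G hG0 hG1 using fun i => exists_aeval_derivative_ne_zero (halg.isAlgebraic (Xs i))
  obtain ⟨y, hy, hne⟩ := exists_eval_ne_zero_of_ne_zero (Finset.prod_ne_zero_iff.2 fun i _ => hG1 i :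
    ∏ i, Polynomial.aeval (Xs i) (G i).derivative ≠ 0)
  rw [map_prod, Finset.prod_ne_zero_iff] at hne
  refine ⟨y, hy, ?_⟩
  let T : (Fin ℓ → ℂ) →ₗ[ℂ] (u → ℂ) := LinearMap.pi fun b => dAt hy b.1
  -- A vector killed by the differentials of the basis is killed by those of everything algebraic
  -- over it, at points where the roots stay simple; in particular its coordinates vanish.
  have hT : Function.Injective T := by
    rw [← LinearMap.ker_eq_bot, LinearMap.ker_eq_bot']
    intro v hv
    have hS : ∀ s ∈ S, dAt hy s v = 0 := by
      intro s hs
      induction hs using Algebra.adjoin_induction with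
      | mem s hs => exact congrFun hv ⟨s, hs⟩
      | algebraMap r => rw [dAt_algebraMap]; rfl
      | add a b _ _ ha hb => rw [dAt_add, LinearMap.add_apply, ha, hb, add_zero]
      | mul a b _ _ ha hb => simp [dAt_mul, ha, hb]
    funext i
    have h1 := dAt_aeval_polynomial hy v S hS (Xs i) (G i)
    rw [hG0, show dAt hy (0 : B) v = 0 by simp [dAt_apply], dAt_X] at h1
    exact (mul_eq_zero.1 h1.symm).resolve_left (hne i (Finset.mem_univ i))
  have hTs : Function.Surjective T := by
    refine (LinearMap.injective_iff_surjective_of_finrank_eq_finrank ?_).1 hT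
    simp [hcard]
  have hYinj : Function.Injective Y := hY.injective
  rw [Fintype.linearIndependent_iff]
  intro c hc i
  obtain ⟨v, hv⟩ := hTs (Pi.single ⟨Y i, hYu ⟨i, rfl⟩⟩ 1)
  have h1 := DFunLike.congr_fun hc v
  simp only [LinearMap.coe_sum, Finset.sum_apply, LinearMap.smul_apply, smul_eq_mul,
    LinearMap.zero_apply] at h1
  have h2 : ∀ j, dAt hy (Y j) v = if j = i then 1 else 0 := by
    intro j
    have := congrFun hv ⟨Y j, hYu ⟨j, rfl⟩⟩
    rw [show dAt hy (Y j) v = T v ⟨Y j, hYu ⟨j, rfl⟩⟩ from rfl, hv, Pi.single_apply]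
    simp [hYinj.eq_iff]
  simpa [h2] using h1

end GenericRank

/-! ### Images of dominant morphisms -/

section Dominant

open MvPolynomial

/-- The image of a morphism of finite type between affine varieties over `ℂ`, the target being an
affine space, contains a nonempty Zariski-open set if the morphism is dominant. -/
theorem exists_algHom_of_eval_ne_zero {k : ℕ} {B : Type} [CommRing B] [IsDomain B] [Algebra ℂ B]
    [Algebra.FiniteType ℂ B] {Y : Fin k → B} (hY : AlgebraicIndependent ℂ Y) :
    ∃ G : MvPolynomial (Fin k) ℂ, G ≠ 0 ∧ ∀ t, eval t G ≠ 0 → ∃ ψ : B →ₐ[ℂ] ℂ, ∀ i, ψ (Y i) = t i := by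
  let φ : MvPolynomial (Fin k) ℂ →+* B := (aeval Y : MvPolynomial (Fin k) ℂ →ₐ[ℂ] B).toRingHom
  have hφ : Function.Injective φ := hY
  have hft : φ.FiniteType := by
    have : (φ.comp (C : ℂ →+* MvPolynomial (Fin k) ℂ)).FiniteType := by
      have h1 : φ.comp (C : ℂ →+* MvPolynomial (Fin k) ℂ) = algebraMap ℂ B := by
        ext r; simp [φ]
      rw [h1, RingHom.finiteType_algebraMap]
      infer_instance
    exact RingHom.FiniteType.of_comp_finiteType this
  have hfp : φ.FinitePresentation := RingHom.FinitePresentation.of_finiteType.1 hft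
  obtain ⟨S, hS⟩ := PrimeSpectrum.exists_constructibleSetData_iff.2
    (PrimeSpectrum.isConstructible_range_comap hfp)
  -- By Chevalley the image is constructible. The piece containing the generic point has no
  -- nontrivial equations, so it is a basic open set.
  have hbot : (⊥ : PrimeSpectrum (MvPolynomial (Fin k) ℂ)) ∈ S.toSet := by
    rw [hS]
    refine ⟨⊥, ?_⟩
    ext p
    simpa using map_eq_zero_iff φ hφ
  simp only [PrimeSpectrum.ConstructibleSetData.toSet, Set.mem_iUnion] at hbot
  obtain ⟨c, hc, hcbot⟩ := hbot
  have hg : ∀ i, c.g i = 0 := by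
    intro i
    simpa using hcbot.1 ⟨i, rfl⟩
  have hf : c.f ≠ 0 := by
    intro h0
    apply hcbot.2
    simp [h0]
  refine ⟨c.f, hf, fun t ht => ?_⟩
  have hmem : (⟨vanishingIdeal ℂ {t}, inferInstance⟩ : PrimeSpectrum (MvPolynomial (Fin k) ℂ)) ∈
      Set.range (PrimeSpectrum.comap φ) := by
    rw [← hS]
    simp only [PrimeSpectrum.ConstructibleSetData.toSet, Set.mem_iUnion]
    refine ⟨c, hc, ?_, ?_⟩
    · rintro _ ⟨i, rfl⟩
      rw [hg]; exact zero_mem _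
    · intro hm
      have : c.f ∈ vanishingIdeal ℂ {t} := hm rfl
      rw [mem_vanishingIdeal_singleton_iff] at this
      exact ht (by simpa using this)
  obtain ⟨Q, hQ⟩ := hmem
  -- A closed point of the fibre: its residue field is finite over `ℂ`, hence embeds in `ℂ`.
  obtain ⟨M, hM, hQM⟩ := Q.asIdeal.exists_le_maximal Q.isPrime.ne_top
  let _ : Field (B ⧸ M) := Ideal.Quotient.field M
  have : Module.Finite ℂ (B ⧸ M) := finite_of_finite_type_of_isJacobsonRing ℂ (B ⧸ M)
  let θ : (B ⧸ M) →ₐ[ℂ] ℂ := IsAlgClosed.lift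
  refine ⟨θ.comp (Ideal.Quotient.mkₐ ℂ M), fun i => ?_⟩
  have h1 : (X i - C (t i) : MvPolynomial (Fin k) ℂ) ∈ vanishingIdeal ℂ {t} := by
    rw [mem_vanishingIdeal_singleton_iff]; simp
  have h2 : φ (X i - C (t i)) ∈ Q.asIdeal := by
    have : vanishingIdeal ℂ {t} = Q.asIdeal.comap φ := (congrArg PrimeSpectrum.asIdeal hQ).symm
    rw [this] at h1
    exact h1
  have h3 : Y i - algebraMap ℂ B (t i) ∈ M := by
    have := hQM h2
    simpa [φ] using this
  have h4 : Ideal.Quotient.mkₐ ℂ M (Y i - algebraMap ℂ B (t i)) = 0 :=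
    Ideal.Quotient.eq_zero_iff_mem.2 h3
  have h5 := congrArg θ h4
  rw [map_sub, map_sub, AlgHom.commutes, AlgHom.commutes, map_zero, sub_eq_zero] at h5
  simpa using h5

variable {ℓ : ℕ} {h : MvPolynomial (Fin ℓ) ℂ}

/-- Inverting `g` as well keeps the `Y i` independent and forces the point found to avoid `g = 0`.
-/
theorem exists_point_of_eval_ne_zero [hh : Fact (h ≠ 0)] {k : ℕ} {Y : Fin k → Localization.Away h}
    (hY : AlgebraicIndependent ℂ Y) {g : MvPolynomial (Fin ℓ) ℂ} (hg : g ≠ 0) :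
    ∃ G : MvPolynomial (Fin k) ℂ, G ≠ 0 ∧ ∀ t, eval t G ≠ 0 →
      ∃ (x : Fin ℓ → ℂ) (hx : eval x h ≠ 0), eval x g ≠ 0 ∧ ∀ i, evAt hx (Y i) = t i := by
  let R := MvPolynomial (Fin ℓ) ℂ
  let B := Localization.Away h
  let B' := Localization.Away (algebraMap R B g)
  have hinjR : Function.Injective (algebraMap R B) :=
    IsLocalization.injective B (powers_le_nonZeroDivisors_of_noZeroDivisors hh.out)
  have hg' : algebraMap R B g ≠ 0 := by rwa [map_ne_zero_iff _ hinjR]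
  have hle := powers_le_nonZeroDivisors_of_noZeroDivisors hg'
  have hinjB : Function.Injective (algebraMap B B') := IsLocalization.injective B' hle
  have : IsDomain B' := IsLocalization.isDomain_localization hle
  have : Algebra.FiniteType R B := IsLocalization.finiteType_of_monoid_fg (Submonoid.powers h) B
  have : Algebra.FiniteType B B' :=
    IsLocalization.finiteType_of_monoid_fg (Submonoid.powers (algebraMap R B g)) B'
  have : Algebra.FiniteType ℂ B := Algebra.FiniteType.trans (S := R) inferInstance inferInstance
  have : Algebra.FiniteType ℂ B' := Algebra.FiniteType.trans (S := B) inferInstance inferInstance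
  let ι : B →ₐ[ℂ] B' := Algebra.algHom ℂ B B'
  have hY' : AlgebraicIndependent ℂ (ι ∘ Y) := hY.map' (f := ι) hinjB
  obtain ⟨G, hG, hGt⟩ := exists_algHom_of_eval_ne_zero hY'
  refine ⟨G, hG, fun t ht => ?_⟩
  obtain ⟨ψ, hψ⟩ := hGt t ht
  let ρ : R →ₐ[ℂ] B := Algebra.algHom ℂ R B
  let x : Fin ℓ → ℂ := fun i => ψ (ι (ρ (X i)))
  have hρ : ∀ P : R, ψ (ι (ρ P)) = eval x P := by
    have : (ψ.comp ι).comp ρ = aeval x := by ext i; simp [x]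
    intro P
    exact (DFunLike.congr_fun this P).trans (by rw [aeval_eq_eval])
  have hu : IsUnit (ρ h) := IsLocalization.Away.algebraMap_isUnit h
  have hx : eval x h ≠ 0 := by
    rw [← hρ]
    exact ((hu.map ι).map ψ).ne_zero
  have hu' : IsUnit (ι (ρ g)) := IsLocalization.Away.algebraMap_isUnit (algebraMap R B g)
  refine ⟨x, hx, ?_, fun i => ?_⟩
  · rw [← hρ]
    exact (hu'.map ψ).ne_zero
  · rw [← hψ i]
    have : evAt hx = ψ.comp ι := by
      refine IsLocalization.algHom_ext (Submonoid.powers h) ?_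
      ext i
      change evAt hx (algebraMap R B (X i)) = ψ (ι (ρ (X i)))
      rw [evAt_algebraMap, eval_X]
    rw [this]; rfl

end Dominant

/-! ### Homogenization -/

section Homogenization

open MvPolynomial

theorem eval_smul_of_isHomogeneous {σ : Type*} {P : MvPolynomial σ ℂ} {d : ℕ}
    (hP : P.IsHomogeneous d) (c : ℂ) (w : σ → ℂ) : eval (c • w) P = c ^ d * eval w P := by
  rw [eval_eq, eval_eq, Finset.mul_sum]
  refine Finset.sum_congr rfl fun m hm => ?_
  have hd : m.degree = d := by
    rw [Finsupp.degree_eq_weight_one]; exact hP (mem_support_iff.1 hm)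
  simp only [Pi.smul_apply, smul_eq_mul, mul_pow, Finset.prod_mul_distrib]
  rw [Finset.prod_pow_eq_pow_sum, ← hd, Finsupp.degree_apply]
  ring

/-- Each homogeneous component is padded by a power of the coordinate `o`. This serves both to test
the Zariski closure and to express genericity of ratios as a polynomial condition. -/
theorem exists_homogenization {κ ι : Type*} (G : MvPolynomial κ ℂ) (o : ι) (e : κ → ι) :
    ∃ (N : ℕ) (H : MvPolynomial ι ℂ), H.IsHomogeneous N ∧ ∀ w : ι → ℂ, w o ≠ 0 →
      eval w H = w o ^ N * eval (fun i => w (e i) / w o) G := by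
  refine ⟨G.totalDegree, ∑ d ∈ Finset.range (G.totalDegree + 1),
    X o ^ (G.totalDegree - d) * rename e (homogeneousComponent d G), ?_, fun w hw => ?_⟩
  · refine IsHomogeneous.sum _ _ _ fun d hd => ?_
    have hd' : d ≤ G.totalDegree := Nat.lt_succ_iff.1 (Finset.mem_range.1 hd)
    have := ((isHomogeneous_X_pow (R := ℂ) o (G.totalDegree - d))).mul
      ((homogeneousComponent_isHomogeneous d G).rename_isHomogeneous (f := e))
    rwa [Nat.sub_add_cancel hd'] at this
  · have hG := congrArg (eval fun i => w (e i) / w o) (sum_homogeneousComponent G)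
    rw [← hG, map_sum, map_sum, Finset.mul_sum]
    refine Finset.sum_congr rfl fun d hd => ?_
    have hd' : d ≤ G.totalDegree := Nat.lt_succ_iff.1 (Finset.mem_range.1 hd)
    have h1 : (fun i => w (e i) / w o) = (w o)⁻¹ • (w ∘ e) := by
      funext i; simp [div_eq_inv_mul]
    rw [h1, eval_smul_of_isHomogeneous (homogeneousComponent_isHomogeneous d G), map_mul, map_pow,
      eval_X, eval_rename, ← mul_assoc, inv_pow, ← div_eq_mul_inv, pow_sub₀ _ hw hd', div_eq_mul_inv]

end Homogenization

/-! ### Linear algebra of families of covectors -/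

section Wedge

variable {V : Type*} [AddCommGroup V] [Module ℂ V]

/-- A functional vanishing on the image of the evaluation map would be a linear relation among the
covectors. -/
theorem exists_dual_vectors {ι : Type*} [Fintype ι] [DecidableEq ι] {η : ι → Module.Dual ℂ V}
    (hη : LinearIndependent ℂ η) : ∃ v : ι → V, ∀ i j, η j (v i) = if i = j then 1 else 0 := by
  let T : V →ₗ[ℂ] (ι → ℂ) := LinearMap.pi η
  have hT : Function.Surjective T := by
    rw [← LinearMap.range_eq_top]
    by_contra hne
    obtain ⟨f, hf0, hf⟩ := Submodule.exists_le_ker_of_lt_top _ (lt_top_iff_ne_top.2 hne)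
    apply hf0
    have h1 : ∑ i, f (fun j => if i = j then 1 else 0) • η i = 0 := by
      ext v
      have h2 : f (T v) = 0 := hf ⟨v, rfl⟩
      rw [LinearMap.pi_apply_eq_sum_univ f] at h2
      simpa [T, mul_comm] using h2
    have h2 := Fintype.linearIndependent_iff.1 hη _ h1
    refine LinearMap.ext fun w => ?_
    rw [LinearMap.pi_apply_eq_sum_univ f]
    simp [h2]
  choose v hv using fun i => hT (Pi.single i 1)
  refine ⟨v, fun i j => ?_⟩
  have := congrFun (hv i) j
  rw [show T (v i) j = η j (v i) from rfl] at this
  rw [this, Pi.single_apply]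
  simp [eq_comm]

/-- Nonvanishing is detected by the determinant of the values on dual vectors, which is `1`. -/
theorem ιMulti_ne_zero_iff {p : ℕ} {η : Fin p → Module.Dual ℂ V} :
    ExteriorAlgebra.ιMulti ℂ p η ≠ 0 ↔ LinearIndependent ℂ η := by
  refine ⟨fun h => ?_, fun h h0 => ?_⟩
  · by_contra hli
    exact h (AlternatingMap.map_linearDependent _ _ hli)
  · obtain ⟨v, hv⟩ := exists_dual_vectors h
    let L : Module.Dual ℂ V →ₗ[ℂ] (Fin p → ℂ) := LinearMap.pi fun i => Module.Dual.eval ℂ V (v i)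
    let D : Module.Dual ℂ V [⋀^Fin p]→ₗ[ℂ] ℂ :=
      (Matrix.detRowAlternating (n := Fin p) (R := ℂ)).compLinearMap L
    have h1 : ExteriorAlgebra.liftAlternating (Pi.single p D)
        (ExteriorAlgebra.ιMulti ℂ p η) = D η := by
      rw [ExteriorAlgebra.liftAlternating_apply_ιMulti, Pi.single_eq_same]
    rw [h0, map_zero] at h1
    have h2 : D η = 1 := by
      change Matrix.det (fun i => L (η i)) = 1
      have : (fun i => L (η i)) = (1 : Matrix (Fin p) (Fin p) ℂ) := by
        ext i j
        simp [L, hv, Matrix.one_apply, eq_comm]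
      rw [this, Matrix.det_one]
    rw [h2] at h1
    exact zero_ne_one h1

end Wedge

open MvPolynomial

/-- Row rank equals column rank, read through the dual map. -/
theorem finrank_range_pi {V : Type*} [AddCommGroup V] [Module ℂ V] [FiniteDimensional ℂ V] {ι : Type*}
    [Fintype ι] (η : ι → Module.Dual ℂ V) :
    Module.finrank ℂ (LinearMap.range (LinearMap.pi η)) =
      Module.finrank ℂ (Submodule.span ℂ (Set.range η)) := by
  classical
  suffices hr : LinearMap.range (LinearMap.pi η).dualMap = Submodule.span ℂ (Set.range η) by
    rw [← LinearMap.finrank_range_dualMap_eq_finrank_range, hr]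
  refine le_antisymm ?_ ?_
  · rintro _ ⟨f, rfl⟩
    have : (LinearMap.pi η).dualMap f = ∑ i, f (fun j => if i = j then 1 else 0) • η i := by
      ext v
      rw [LinearMap.dualMap_apply, LinearMap.pi_apply_eq_sum_univ f]
      simp [mul_comm]
    rw [this]
    exact Submodule.sum_mem _ fun i _ => Submodule.smul_mem _ _ (Submodule.subset_span ⟨i, rfl⟩)
  · rw [Submodule.span_le]
    rintro _ ⟨i, rfl⟩
    exact ⟨LinearMap.proj i, by ext v; simp⟩

/-! ### Logarithmic differentials -/

section LogDerivative

variable {ℓ : ℕ} {h : MvPolynomial (Fin ℓ) ℂ} {x : Fin ℓ → ℂ}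

/-- The logarithmic differential at `x` of invertible regular functions on `h ≠ 0`. -/
def dlogAt (hx : eval x h ≠ 0) :
    (Localization.Away h)ˣ →* Multiplicative (Module.Dual ℂ (Fin ℓ → ℂ)) where
  toFun u := Multiplicative.ofAdd ((evAt hx u)⁻¹ • dAt hx u)
  map_one' := by
    have : dAt hx 1 = 0 := by simpa using dAt_algebraMap hx 1
    simp [this]
  map_mul' u v := by
    have hu : evAt hx (u : Localization.Away h) ≠ 0 := (u.isUnit.map (evAt hx)).ne_zero
    have hv : evAt hx (v : Localization.Away h) ≠ 0 := (v.isUnit.map (evAt hx)).ne_zero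
    rw [← ofAdd_add]
    congr 1
    ext w
    simp only [Units.val_mul, map_mul, dAt_mul, LinearMap.comp_apply, LinearMap.smul_apply,
      LinearMap.add_apply, smul_eq_mul]
    field_simp
    ring

theorem dAt_unit (hx : eval x h ≠ 0) (u : (Localization.Away h)ˣ) :
    dAt hx u = evAt hx u • (dlogAt hx u).toAdd := by
  have hu : evAt hx (u : Localization.Away h) ≠ 0 := (u.isUnit.map (evAt hx)).ne_zero
  simp [dlogAt, smul_smul, mul_inv_cancel₀ hu]

theorem hasFDerivAt_prod_zpow {E : Type*} [NormedAddCommGroup E] [NormedSpace ℂ E] {ι : Type*}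
    (s : Finset ι) {F : ι → E → ℂ} {L : ι → E →L[ℂ] ℂ} {x : E} (hF : ∀ i, HasFDerivAt (F i) (L i) x)
    (hF0 : ∀ i, F i x ≠ 0) (m : ι → ℤ) :
    HasFDerivAt (fun y => ∏ i ∈ s, F i y ^ m i)
      ((∏ i ∈ s, F i x ^ m i) • ∑ i ∈ s, (m i : ℂ) • (F i x)⁻¹ • L i) x := by
  classical
  induction s using Finset.induction_on with
  | empty => simpa using hasFDerivAt_const (1 : ℂ) x
  | insert i s hi ih =>
    simp only [Finset.prod_insert hi, Finset.sum_insert hi]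
    have h1 := (hasDerivAt_zpow (m i) (F i x) (Or.inl (hF0 i))).comp_hasFDerivAt x (hF i)
    refine (h1.mul ih).congr_fderiv ?_
    ext v
    simp only [Function.comp_apply, _root_.add_apply, _root_.smul_apply,
      smul_eq_mul, zpow_sub_one₀ (hF0 i)]
    ring

end LogDerivative

/-! ### The functions of the arrangement as regular functions on U -/

namespace Arrangement

variable {ℓ n : ℕ} (A : Arrangement ℓ n)

/-- The linear part of `f j`. -/
def lin (j : Fin (n + 1)) : Module.Dual ℂ (Fin ℓ → ℂ) :=
  ∑ i : Fin ℓ, A.α j (fun l => if i.succ = l then 1 else 0) • LinearMap.proj i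

/-- The polynomial defining `f j`. -/
def poly (j : Fin (n + 1)) : MvPolynomial (Fin ℓ) ℂ :=
  C (A.α j (fun l => if 0 = l then 1 else 0)) +
    ∑ i : Fin ℓ, C (A.α j (fun l => if i.succ = l then 1 else 0)) * X i

theorem f_eq (j : Fin (n + 1)) (x : Fin ℓ → ℂ) :
    A.f j x = A.α j (fun l => if 0 = l then 1 else 0) + A.lin j x := by
  rw [f, LinearMap.pi_apply_eq_sum_univ, Fin.sum_univ_succ]
  simp [lin, mul_comm]

theorem eval_poly (j : Fin (n + 1)) (x : Fin ℓ → ℂ) : eval x (A.poly j) = A.f j x := by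
  simp [f_eq, poly, lin]

theorem eval_dirDeriv_poly (j : Fin (n + 1)) (x v : Fin ℓ → ℂ) :
    eval x (dirDeriv v (A.poly j)) = A.lin j v := by
  classical
  simp [dirDeriv_apply, poly, lin, MvPolynomial.smul_eval, Pi.single_apply, mul_comm]

theorem fderiv_f (j : Fin (n + 1)) (x : Fin ℓ → ℂ) :
    HasFDerivAt (A.f j) (A.lin j).toContinuousLinearMap x := by
  have h1 : A.f j = fun x => A.α j (fun l => if 0 = l then 1 else 0) +
      (A.lin j).toContinuousLinearMap x := by
    funext x; rw [f_eq]; rfl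
  rw [h1]
  exact (ContinuousLinearMap.hasFDerivAt _).const_add _

theorem poly_ne_zero (j : Fin (n + 1)) : A.poly j ≠ 0 := by
  intro h0
  have hf : ∀ x, A.f j x = 0 := fun x => by rw [← eval_poly, h0, map_zero]
  have h1 : A.α j (fun l => if 0 = l then 1 else 0) = 0 := by
    simpa [f_eq] using hf 0
  have h2 : ∀ x, A.lin j x = 0 := fun x => by simpa [f_eq, h1] using hf x
  refine A.ne_zero j (LinearMap.ext fun w => ?_)
  rw [LinearMap.pi_apply_eq_sum_univ, Fin.sum_univ_succ, h1]
  have h3 : ∀ i : Fin ℓ, A.α j (fun l => if i.succ = l then 1 else 0) = 0 := by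
    intro i
    simpa [lin, Pi.single_apply] using h2 (Pi.single i 1)
  simp [h3]

/-- The defining polynomial of the arrangement. -/
def defPoly : MvPolynomial (Fin ℓ) ℂ := ∏ j, A.poly j

instance : Fact (A.defPoly ≠ 0) := ⟨Finset.prod_ne_zero_iff.2 fun j _ => A.poly_ne_zero j⟩

theorem mem_U_iff {x : Fin ℓ → ℂ} : x ∈ A.U ↔ eval x A.defPoly ≠ 0 := by
  simp [U, defPoly, map_prod, Finset.prod_ne_zero_iff, eval_poly]

/-- The invertible regular function `f j` on `U`. -/
def unit (j : Fin (n + 1)) : (Localization.Away A.defPoly)ˣ :=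
  IsUnit.unit (a := algebraMap _ _ (A.poly j)) <| by
    refine isUnit_of_dvd_unit (map_dvd (algebraMap _ _) ?_)
      (IsLocalization.Away.algebraMap_isUnit A.defPoly)
    exact Finset.dvd_prod_of_mem _ (Finset.mem_univ j)

variable {q : ℕ} (ξ : Fin q → Fin (n + 1) → ℤ)

/-- The invertible regular function `Φ_{ξ_i}` on `U`. -/
def Y (i : Fin q) : Localization.Away A.defPoly := ((∏ j, A.unit j ^ ξ i j : (Localization.Away A.defPoly)ˣ))

variable {x : Fin ℓ → ℂ}

theorem evAt_unit (hx : eval x A.defPoly ≠ 0) (j : Fin (n + 1)) :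
    evAt hx (A.unit j : Localization.Away A.defPoly) = A.f j x := by
  simp [unit, eval_poly]

theorem evAt_Y (hx : eval x A.defPoly ≠ 0) (i : Fin q) : evAt hx (A.Y ξ i) = A.Phi ξ x i := by
  have h1 : evAt hx (A.Y ξ i) = ((Units.map (evAt hx : Localization.Away A.defPoly →* ℂ)
      (∏ j, A.unit j ^ ξ i j) : ℂˣ) : ℂ) := rfl
  rw [h1, map_prod, Units.coe_prod, Phi]
  refine Finset.prod_congr rfl fun j _ => ?_
  rw [map_zpow, Units.val_zpow_eq_zpow_val, Units.coe_map, ← A.evAt_unit hx]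
  rfl

theorem Phi_ne_zero (hx : x ∈ A.U) (i : Fin q) : A.Phi ξ x i ≠ 0 :=
  Finset.prod_ne_zero_iff.2 fun j _ => zpow_ne_zero _ (hx j)

theorem dlog_apply (hx : x ∈ A.U) (j : Fin (n + 1)) : A.dlog j ⟨x, hx⟩ = (A.f j x)⁻¹ • A.lin j := by
  rw [dlog, (A.fderiv_f j x).fderiv]
  rfl

theorem omega_apply (hx : x ∈ A.U) (w : Fin (n + 1) → ℂ) :
    A.omega w ⟨x, hx⟩ = ∑ j, w j • (A.f j x)⁻¹ • A.lin j := by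
  simp [omega, Finset.sum_apply, dlog_apply]

theorem dlogAt_unit (hx : eval x A.defPoly ≠ 0) (j : Fin (n + 1)) :
    (dlogAt hx (A.unit j)).toAdd = (A.f j x)⁻¹ • A.lin j := by
  have h1 : dAt hx (A.unit j : Localization.Away A.defPoly) = A.lin j := by
    refine LinearMap.ext fun v => ?_
    change dAt hx (algebraMap _ _ (A.poly j)) v = _
    rw [dAt_algebraMap_apply, eval_dirDeriv_poly]
  rw [← h1, ← A.evAt_unit hx]
  rfl

theorem dAt_Y (hx : eval x A.defPoly ≠ 0) (i : Fin q) :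
    dAt hx (A.Y ξ i) = A.Phi ξ x i • A.omegaFamily ξ i ⟨x, A.mem_U_iff.2 hx⟩ := by
  rw [← evAt_Y (hx := hx), Y, dAt_unit, map_prod, omegaFamily, omega_apply, toAdd_prod]
  congr 1
  refine Finset.sum_congr rfl fun j _ => ?_
  rw [map_zpow, toAdd_zpow, dlogAt_unit, Int.cast_smul_eq_zsmul]

/-- The bridge between the analytic Jacobian and the algebraic differentials. -/
theorem hasFDerivAt_Phi (hx : eval x A.defPoly ≠ 0) :
    HasFDerivAt (A.Phi ξ) (LinearMap.toContinuousLinearMap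
      (LinearMap.pi fun i => dAt hx (A.Y ξ i))) x := by
  have hU := A.mem_U_iff.2 hx
  rw [hasFDerivAt_pi']
  intro i
  have h1 := hasFDerivAt_prod_zpow Finset.univ (fun j => A.fderiv_f j x) (fun j => hU j) (ξ i)
  refine h1.congr_fderiv ?_
  ext v
  simp [dAt_Y, omegaFamily, omega_apply, Phi]

theorem PhiRank_eq (hx : eval x A.defPoly ≠ 0) : A.PhiRank ξ x =
    Module.finrank ℂ (Submodule.span ℂ (Set.range fun i => dAt hx (A.Y ξ i))) := by
  rw [PhiRank, (A.hasFDerivAt_Phi ξ hx).fderiv, ← finrank_range_pi]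
  rfl

end Arrangement

/-! ### Smoothness of a projective hyperplane -/

section Projective

open scoped LinearAlgebra.Projectivization

variable {q : ℕ}

theorem mk_mem_hyperplane_iff (b : Fin (q + 1) → ℂ) (v : Fin (q + 1) → ℂ) (hv : v ≠ 0) :
    Projectivization.mk ℂ v hv ∈ hyperplane b ↔ ∑ j, b j * v j = 0 := by
  obtain ⟨c, hc⟩ := Projectivization.exists_smul_eq_mk_rep ℂ v hv
  have h1 : ∑ j, b j * (c • v) j = c * ∑ j, b j * v j := by
    rw [Finset.mul_sum]
    exact Finset.sum_congr rfl fun j _ => by simp [Units.smul_def]; ring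
  rw [hyperplane, Set.mem_ofPred_eq, ← hc, h1]
  simp

theorem eval_rep_mk_eq_zero_iff {P : MvPolynomial (Fin (q + 1)) ℂ} {d : ℕ} (hP : P.IsHomogeneous d)
    (v : Fin (q + 1) → ℂ) (hv : v ≠ 0) :
    eval (Projectivization.mk ℂ v hv).rep P = 0 ↔ eval v P = 0 := by
  obtain ⟨c, hc⟩ := Projectivization.exists_smul_eq_mk_rep ℂ v hv
  rw [← hc, Units.smul_def, eval_smul_of_isHomogeneous hP]
  simp

/-- The line `y + s • w` lies in the hyperplane, so `P` vanishes on it for all `s` but at most one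
(where the vector may be zero), hence identically. Putting `s = ε` extracts the linear coefficient.
-/
theorem sum_mul_eval_pderiv_eq_zero {b : Fin (q + 1) → ℂ} {P : MvPolynomial (Fin (q + 1)) ℂ}
    (hP : VanishesOn (hyperplane b) P) {y w : Fin (q + 1) → ℂ} (hy : y ≠ 0)
    (hyb : ∑ j, b j * y j = 0) (hwb : ∑ j, b j * w j = 0) :
    ∑ j, w j * eval y (pderiv j P) = 0 := by
  obtain ⟨⟨d, hd⟩, hP⟩ := hP
  let p : Polynomial ℂ := aeval (fun i => Polynomial.C (y i) + Polynomial.X * Polynomial.C (w i)) P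
  have hp : ∀ s, p.eval s = eval (y + s • w) P := by
    intro s
    have : ((Polynomial.aeval s).comp
        (aeval fun i => Polynomial.C (y i) + Polynomial.X * Polynomial.C (w i)) :
          MvPolynomial (Fin (q + 1)) ℂ →ₐ[ℂ] ℂ) = aeval (y + s • w) := by
      ext i; simp; ring
    have h1 := DFunLike.congr_fun this P
    rwa [aeval_eq_eval, AlgHom.comp_apply, Polynomial.coe_aeval_eq_eval] at h1
  have hsub : {s : ℂ | y + s • w = 0}.Subsingleton := by
    intro s hs t ht
    by_contra hst
    have h1 : (s - t) • w = 0 := by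
      rw [sub_smul, sub_eq_zero]
      exact add_left_cancel ((show y + s • w = 0 from hs).trans (show y + t • w = 0 from ht).symm)
    have hw : w = 0 := (smul_eq_zero.1 h1).resolve_left (sub_ne_zero.2 hst)
    apply hy
    simpa [hw] using (show y + s • w = 0 from hs)
  have hp0 : p = 0 := by
    refine Polynomial.eq_zero_of_infinite_isRoot p (hsub.finite.infinite_compl.mono fun s hs => ?_)
    rw [Set.mem_ofPred_eq, Polynomial.IsRoot.def, hp, ← eval_rep_mk_eq_zero_iff hd _ hs]
    refine hP _ ((mk_mem_hyperplane_iff _ _ _).2 ?_)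
    have : ∑ j, b j * (y + s • w) j = ∑ j, b j * y j + s * ∑ j, b j * w j := by
      rw [Finset.mul_sum, ← Finset.sum_add_distrib]
      exact Finset.sum_congr rfl fun j _ => by simp; ring
    rw [this, hyb, hwb, mul_zero, add_zero]
  have h1 : Polynomial.aeval (DualNumber.eps : DualNumber ℂ) p = dualEval y w P := by
    have : ((Polynomial.aeval (DualNumber.eps : DualNumber ℂ)).comp
        (aeval fun i => Polynomial.C (y i) + Polynomial.X * Polynomial.C (w i)) :
          MvPolynomial (Fin (q + 1)) ℂ →ₐ[ℂ] DualNumber ℂ) = dualEval y w := by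
      ext i <;> simp [dualEval, TrivSqZeroExt.algebraMap_eq_inl']
    exact DFunLike.congr_fun this P
  rw [← snd_dualEval, ← h1, hp0, map_zero, TrivSqZeroExt.snd_zero]

theorem jacobianRank_hyperplane {b : Fin (q + 1) → ℂ} (hb : b 0 ≠ 0)
    {y : ℙ ℂ (Fin (q + 1) → ℂ)} (hy : y ∈ hyperplane b) : jacobianRank (hyperplane b) y = 1 := by
  classical
  have hspan : Submodule.span ℂ {v : Fin (q + 1) → ℂ | ∃ P, VanishesOn (hyperplane b) P ∧
      v = fun j => eval y.rep (pderiv j P)} = Submodule.span ℂ {b} := by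
    refine le_antisymm ?_ ?_
    · rw [Submodule.span_le]
      rintro v ⟨P, hP, rfl⟩
      refine Submodule.mem_span_singleton.2 ⟨eval y.rep (pderiv 0 P) / b 0, funext fun i => ?_⟩
      -- These tangent vectors force the gradient of `P` to be proportional to `b`.
      have h1 := sum_mul_eval_pderiv_eq_zero hP (w := b 0 • Pi.single i 1 - b i • Pi.single 0 1)
        y.rep_nonzero hy (by
          simp [mul_sub, Finset.sum_sub_distrib, Pi.single_apply, mul_comm])
      simp only [Pi.sub_apply, Pi.smul_apply, Pi.single_apply, smul_eq_mul, mul_ite, mul_one, mul_zero,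
        sub_mul, ite_mul, zero_mul, Finset.sum_sub_distrib, Finset.sum_ite_eq', Finset.mem_univ,
        if_true] at h1
      simp only [Pi.smul_apply, smul_eq_mul]
      field_simp
      linear_combination -h1
    · rw [Submodule.span_singleton_le_iff_mem]
      refine Submodule.subset_span ⟨∑ j, C (b j) * X j, ⟨⟨1, ?_⟩, ?_⟩, ?_⟩
      · refine IsHomogeneous.sum _ _ _ fun j _ => ?_
        simpa using (isHomogeneous_C (Fin (q + 1)) (b j)).mul (isHomogeneous_X ℂ j)
      · intro z hz
        simpa using (show ∑ j, b j * z.rep j = 0 from hz)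
      · funext i
        simp [Pi.single_apply]
  rw [jacobianRank, hspan]
  exact finrank_span_singleton fun h0 => hb (congrFun h0 0)

theorem singVariety_hyperplane {b : Fin (q + 1) → ℂ} (hb : b 0 ≠ 0) :
    singVariety (hyperplane b) = ∅ := by
  refine Set.eq_empty_of_forall_notMem ?_
  rintro y ⟨hy, y', hy', hlt⟩
  rw [jacobianRank_hyperplane hb hy, jacobianRank_hyperplane hb hy'] at hlt
  exact lt_irrefl _ hlt

end Projective

/-! ### Rank and singular set when Ȳ is a hyperplane -/

namespace Arrangement

variable {ℓ n q : ℕ} (A : Arrangement ℓ n) {ξ : Fin q → Fin (n + 1) → ℤ} {b : Fin (q + 1) → ℂ}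

theorem U_nonempty : A.U.Nonempty := by
  by_contra hcon
  refine (inferInstance : Fact (A.defPoly ≠ 0)).out (MvPolynomial.funext fun x => ?_)
  by_contra hx
  exact hcon ⟨x, A.mem_U_iff.2 (by simpa using hx)⟩

theorem Phi_relation (hY : A.Ybar ξ = hyperplane b) {x : Fin ℓ → ℂ} (hx : x ∈ A.U) :
    b 0 + ∑ i, b i.succ * A.Phi ξ x i = 0 := by
  have h1 : A.PhiProj ξ x ∈ A.Ybar ξ := fun P hP => hP.2 _ ⟨x, hx, rfl⟩
  rw [hY, PhiProj, mk_mem_hyperplane_iff, Fin.sum_univ_succ] at h1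
  simpa using h1

theorem Y_relation (hY : A.Ybar ξ = hyperplane b) :
    algebraMap ℂ _ (b 0) + ∑ i, b i.succ • A.Y ξ i = 0 := by
  refine eq_zero_of_forall_evAt fun x hx => ?_
  have := A.Phi_relation hY (A.mem_U_iff.2 hx)
  simpa [evAt_Y] using this

theorem dAt_relation (hY : A.Ybar ξ = hyperplane b) {x : Fin ℓ → ℂ} (hx : eval x A.defPoly ≠ 0) :
    ∑ i, b i.succ • dAt hx (A.Y ξ i) = 0 := by
  have h1 := congrArg (dAt hx) (A.Y_relation hY)
  rw [dAt_add, dAt_algebraMap, zero_add, dAt_sum] at h1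
  simp only [dAt_smul] at h1
  rw [h1]
  ext; simp [dAt_apply]

theorem q_ne_zero (hb : b 0 ≠ 0) (hY : A.Ybar ξ = hyperplane b) : q ≠ 0 := by
  rintro rfl
  obtain ⟨x, hx⟩ := A.U_nonempty
  exact hb (by simpa using A.Phi_relation hY hx)

end Arrangement

namespace Arrangement

variable {ℓ n k : ℕ} (A : Arrangement ℓ n) {ξ : Fin (k + 1) → Fin (n + 1) → ℤ}
  {b : Fin (k + 1 + 1) → ℂ}

theorem algebraicIndependent_Y (hb : ∀ j, b j ≠ 0) (hY : A.Ybar ξ = hyperplane b) :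
    AlgebraicIndependent ℂ fun i : Fin k => A.Y ξ i.castSucc := by
  rw [algebraicIndependent_iff]
  intro F hF
  have hFx : ∀ x ∈ A.U, eval (fun i : Fin k => A.Phi ξ x i.castSucc) F = 0 := by
    intro x hx
    have hx' := A.mem_U_iff.1 hx
    have : (evAt hx').comp (aeval fun i : Fin k => A.Y ξ i.castSucc) =
        aeval fun i : Fin k => A.Phi ξ x i.castSucc := by
      ext i; simp [evAt_Y]
    have h1 := DFunLike.congr_fun this F
    rw [AlgHom.comp_apply, hF, map_zero, aeval_eq_eval] at h1
    exact h1.symm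
  obtain ⟨N, H, hH, hHw⟩ := exists_homogenization F (0 : Fin (k + 1 + 1))
    (fun i : Fin k => i.castSucc.succ)
  have hvan : VanishesOn (A.PhiProj ξ '' A.U) H := by
    refine ⟨⟨N, hH⟩, ?_⟩
    rintro _ ⟨x, hx, rfl⟩
    rw [PhiProj, eval_rep_mk_eq_zero_iff hH, hHw _ (by simp)]
    simp [hFx x hx]
  refine MvPolynomial.funext fun t => ?_
  -- An arbitrary `t` is lifted to the hyperplane by solving for the last coordinate; a relation
  -- valid on the image then holds at every `t`.
  let z : Fin (k + 1 + 1) → ℂ := Fin.cons 1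
    (Fin.snoc (α := fun _ => ℂ) t (-(b 0 + ∑ i : Fin k, b i.castSucc.succ * t i) / b (Fin.last k).succ))
  have hz : z ≠ 0 := fun h0 => one_ne_zero (congrFun h0 0)
  have hmem : Projectivization.mk ℂ z hz ∈ A.Ybar ξ := by
    rw [hY, mk_mem_hyperplane_iff, Fin.sum_univ_succ, Fin.sum_univ_castSucc]
    have := hb (Fin.last k).succ
    simp only [z, Fin.cons_zero, Fin.cons_succ, Fin.snoc_castSucc, Fin.snoc_last]
    field_simp
    ring
  have h1 := hmem H hvan
  rw [eval_rep_mk_eq_zero_iff hH, hHw _ (by simp [z])] at h1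
  simpa [z] using h1

theorem span_dAt_eq (hb : ∀ j, b j ≠ 0) (hY : A.Ybar ξ = hyperplane b) {x : Fin ℓ → ℂ}
    (hx : eval x A.defPoly ≠ 0) : Submodule.span ℂ (Set.range fun i => dAt hx (A.Y ξ i)) =
      Submodule.span ℂ (Set.range fun i : Fin k => dAt hx (A.Y ξ i.castSucc)) := by
  refine le_antisymm (Submodule.span_le.2 ?_) (Submodule.span_mono ?_)
  · rintro _ ⟨i, rfl⟩
    induction i using Fin.lastCases with
    | cast i => exact Submodule.subset_span ⟨i, rfl⟩
    | last =>
      have h1 := A.dAt_relation hY hx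
      rw [Fin.sum_univ_castSucc, add_comm, add_eq_zero_iff_eq_neg] at h1
      have h2 : dAt hx (A.Y ξ (Fin.last k)) = (b (Fin.last k).succ)⁻¹ •
          (b (Fin.last k).succ • dAt hx (A.Y ξ (Fin.last k))) := by
        rw [smul_smul, inv_mul_cancel₀ (hb _), one_smul]
      change dAt hx (A.Y ξ (Fin.last k)) ∈ _
      rw [h2, h1]
      exact Submodule.smul_mem _ _ (Submodule.neg_mem _ (Submodule.sum_mem _ fun i _ =>
        Submodule.smul_mem _ _ (Submodule.subset_span ⟨i, rfl⟩)))
  · rintro _ ⟨i, rfl⟩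
    exact ⟨i.castSucc, rfl⟩

theorem PhiRank_le (hb : ∀ j, b j ≠ 0) (hY : A.Ybar ξ = hyperplane b) {x : Fin ℓ → ℂ}
    (hx : eval x A.defPoly ≠ 0) : A.PhiRank ξ x ≤ k := by
  rw [A.PhiRank_eq ξ hx, A.span_dAt_eq hb hY]
  exact (finrank_range_le_card (R := ℂ) fun i : Fin k => dAt hx (A.Y ξ i.castSucc)).trans_eq
    (Fintype.card_fin k)

theorem PhiRank_eq_iff (hb : ∀ j, b j ≠ 0) (hY : A.Ybar ξ = hyperplane b) {x : Fin ℓ → ℂ}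
    (hx : eval x A.defPoly ≠ 0) :
    A.PhiRank ξ x = k ↔ LinearIndependent ℂ fun i : Fin k => dAt hx (A.Y ξ i.castSucc) := by
  rw [A.PhiRank_eq ξ hx, A.span_dAt_eq hb hY, linearIndependent_iff_card_eq_finrank_span, Fintype.card_fin,
    eq_comm, Set.finrank]

theorem exists_regular (hb : ∀ j, b j ≠ 0) (hY : A.Ybar ξ = hyperplane b) :
    ∃ (x : Fin ℓ → ℂ) (hx : eval x A.defPoly ≠ 0),
      LinearIndependent ℂ fun i : Fin k => dAt hx (A.Y ξ i.castSucc) :=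
  exists_linearIndependent_dAt (A.algebraicIndependent_Y hb hY)

/-- The hyperplane contributes no singular points, and the maximal rank `k` is attained. -/
theorem notMem_S_iff (hb : ∀ j, b j ≠ 0) (hY : A.Ybar ξ = hyperplane b) {x : Fin ℓ → ℂ}
    (hx : eval x A.defPoly ≠ 0) :
    x ∉ A.S ξ ↔ LinearIndependent ℂ fun i : Fin k => dAt hx (A.Y ξ i.castSucc) := by
  rw [← A.PhiRank_eq_iff hb hY, S, hY, singVariety_hyperplane (hb 0)]
  obtain ⟨x₀, hx₀, hreg⟩ := A.exists_regular hb hY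
  rw [← A.PhiRank_eq_iff hb hY] at hreg
  simp only [Set.mem_empty_iff_false, and_false, Set.ofPred_false, Set.union_empty, singPhi,
    Set.mem_ofPred_eq, not_and, not_exists, not_lt]
  constructor
  · intro h1
    exact le_antisymm (A.PhiRank_le hb hY hx) (hreg.symm.trans_le <| h1 (A.mem_U_iff.2 hx) x₀ (A.mem_U_iff.2 hx₀))
  · intro h1 _ y hy
    rw [h1]
    exact A.PhiRank_le hb hY (A.mem_U_iff.1 hy)

/-- At each point ω_{ξ_i} is a nonzero multiple of dY_i, so the values of D span a space of
dimension at most `k`, with equality at a regular point. -/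
theorem rank_D (hb : ∀ j, b j ≠ 0) (hY : A.Ybar ξ = hyperplane b) : A.rank (A.D ξ) = k := by
  refine IsGreatest.csSup_eq ⟨?_, ?_⟩
  · obtain ⟨x, hx, hreg⟩ := A.exists_regular hb hY
    refine ⟨fun i => A.omegaFamily ξ i.castSucc, fun i => Submodule.subset_span ⟨_, rfl⟩, fun h0 => ?_⟩
    refine ιMulti_ne_zero_iff.2 ?_ (congrFun h0 ⟨x, A.mem_U_iff.2 hx⟩)
    rw [Fintype.linearIndependent_iff] at hreg ⊢
    intro c hc i
    have h1 := hreg (fun i => c i * (A.Phi ξ x i.castSucc)⁻¹) (by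
      rw [← hc]
      refine Finset.sum_congr rfl fun i _ => ?_
      rw [dAt_Y, smul_smul, mul_assoc,
        inv_mul_cancel₀ (A.Phi_ne_zero ξ (A.mem_U_iff.2 hx) _), mul_one]) i
    exact (mul_eq_zero.1 h1).resolve_right (inv_ne_zero (A.Phi_ne_zero ξ (A.mem_U_iff.2 hx) _))
  · rintro p ⟨η, hη, hne⟩
    obtain ⟨⟨x, hxU⟩, hxη⟩ := Function.ne_iff.1 hne
    have hx := A.mem_U_iff.1 hxU
    have hli := ιMulti_ne_zero_iff.1 hxη
    let ev : (A.U → Module.Dual ℂ (Fin ℓ → ℂ)) →ₗ[ℂ] Module.Dual ℂ (Fin ℓ → ℂ) :=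
      LinearMap.proj ⟨x, hxU⟩
    have hmem : ∀ i, η i ⟨x, hxU⟩ ∈ Submodule.span ℂ (Set.range fun i => dAt hx (A.Y ξ i)) := by
      intro i
      have hle : A.D ξ ≤ (Submodule.span ℂ (Set.range fun i => dAt hx (A.Y ξ i))).comap ev := by
        rw [D, Submodule.span_le]
        rintro _ ⟨j, rfl⟩
        have h1 : A.omegaFamily ξ j ⟨x, hxU⟩ = (A.Phi ξ x j)⁻¹ • dAt hx (A.Y ξ j) := by
          rw [dAt_Y, smul_smul, inv_mul_cancel₀ (A.Phi_ne_zero ξ hxU _), one_smul]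
        rw [SetLike.mem_coe, Submodule.mem_comap, show ev (A.omegaFamily ξ j) = _ from h1]
        exact Submodule.smul_mem _ _ (Submodule.subset_span ⟨j, rfl⟩)
      exact hle (hη i)
    have h2 : p = Module.finrank ℂ (Submodule.span ℂ (Set.range fun i => η i ⟨x, hxU⟩)) := by
      exact (Fintype.card_fin p).symm.trans (linearIndependent_iff_card_eq_finrank_span.1 hli)
    rw [h2]
    refine (Submodule.finrank_mono (Submodule.span_le.2 ?_)).trans
      ((A.PhiRank_eq ξ hx).symm.le.trans (A.PhiRank_le hb hY hx))
    rintro _ ⟨i, rfl⟩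
    exact hmem i

/-- Linear independence of the differentials is a Zariski-open condition. -/
theorem exists_basic_regular {x : Fin ℓ → ℂ} (hx : eval x A.defPoly ≠ 0)
    (hreg : LinearIndependent ℂ fun i : Fin k => dAt hx (A.Y ξ i.castSucc)) :
    ∃ P : MvPolynomial (Fin ℓ) ℂ, eval x P ≠ 0 ∧ ∀ y, eval y P ≠ 0 → ∃ hy : eval y A.defPoly ≠ 0,
      LinearIndependent ℂ fun i : Fin k => dAt hy (A.Y ξ i.castSucc) := by
  obtain ⟨v, hv⟩ := exists_dual_vectors hreg
  choose m hm using fun j : Fin k => exists_eval_eq_pow_mul_dAt (A.Y ξ j.castSucc)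
  choose N hN using fun i j : Fin k => hm j (v i)
  -- The Jacobian along vectors dual at `x`, with column `j` scaled by a power of `defPoly`: it is
  -- diagonal and invertible at `x`, and its determinant witnesses independence elsewhere.
  let M : Matrix (Fin k) (Fin k) (MvPolynomial (Fin ℓ) ℂ) := Matrix.of N
  have hdet : ∀ y, eval y M.det = ((eval y).mapMatrix M).det := fun y => RingHom.map_det _ _
  refine ⟨A.defPoly * M.det, ?_, fun y hy => ?_⟩
  · rw [map_mul, hdet]
    refine mul_ne_zero hx ?_
    have : (eval x).mapMatrix M = Matrix.diagonal fun j => eval x A.defPoly ^ m j := by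
      ext i j
      simp only [M, RingHom.mapMatrix_apply, Matrix.map_apply, Matrix.of_apply, hN i j x hx, hv,
        Matrix.diagonal_apply, mul_ite, mul_one, mul_zero]
      split_ifs with hij
      · rw [hij]
      · rfl
    rw [this, Matrix.det_diagonal]
    exact Finset.prod_ne_zero_iff.2 fun j _ => pow_ne_zero _ hx
  · rw [map_mul, mul_ne_zero_iff, hdet] at hy
    refine ⟨hy.1, ?_⟩
    rw [Fintype.linearIndependent_iff]
    intro c hc
    have h1 := Matrix.eq_zero_of_mulVec_eq_zero hy.2
      (v := fun j => c j * (eval y A.defPoly ^ m j)⁻¹) (by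
        funext i
        have h2 := DFunLike.congr_fun hc (v i)
        simp only [LinearMap.coe_sum, Finset.sum_apply, LinearMap.smul_apply, smul_eq_mul,
          LinearMap.zero_apply] at h2
        rw [Pi.zero_apply, ← h2, Matrix.mulVec, dotProduct]
        refine Finset.sum_congr rfl fun j _ => ?_
        simp only [M, RingHom.mapMatrix_apply, Matrix.map_apply, Matrix.of_apply, hN i j y hy.1]
        have := pow_ne_zero (m j) hy.1
        field_simp)
    intro i
    exact (mul_eq_zero.1 (congrFun h1 i)).resolve_right (inv_ne_zero (pow_ne_zero _ hy.1))

end Arrangement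

/-! ### Critical points as a fibre -/

namespace Arrangement

variable {ℓ n k : ℕ} (A : Arrangement ℓ n)

/-- The condition Σ a_i = 0 cancels the minimum subtracted in `nu`, and the term of index `0` drops
out since ξ_0 = 0. -/
theorem omega_weights {q : ℕ} (ξ : Fin q → Fin (n + 1) → ℤ) {a : Fin (q + 1) → ℂ}
    (ha : ∑ i, a i = 0) {x : Fin ℓ → ℂ} (hx : x ∈ A.U) :
    A.omega (fun j => ∑ i, a i * (nu ξ i j : ℂ)) ⟨x, hx⟩ =
      ∑ i, a i.succ • A.omegaFamily ξ i ⟨x, hx⟩ := by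
  have h1 : ∀ j, ∑ i, a i * (nu ξ i j : ℂ) = ∑ i : Fin q, a i.succ * (ξ i j : ℂ) := by
    intro j
    simp only [nu, Int.cast_sub, mul_sub, Finset.sum_sub_distrib, ← Finset.sum_mul, ha, zero_mul,
      sub_zero]
    rw [Fin.sum_univ_succ]
    simp [xiExt]
  simp only [h1, omegaFamily, omega_apply, Finset.smul_sum, Finset.sum_smul]
  rw [Finset.sum_comm]
  simp only [smul_smul, mul_assoc]

variable {ξ : Fin (k + 1) → Fin (n + 1) → ℤ} {b : Fin (k + 1 + 1) → ℂ}

/-- At the points where `Φ_Λ` has maximal rank, the critical points are those which are mapped to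
`[a_0 / b_0 : ⋯ : a_q / b_q]`. -/
theorem mem_crit_iff (hb : ∀ j, b j ≠ 0) (hY : A.Ybar ξ = hyperplane b) {a : Fin (k + 1 + 1) → ℂ}
    (ha : ∑ i, a i = 0) (ha0 : a 0 ≠ 0) {x : Fin ℓ → ℂ} (hx : eval x A.defPoly ≠ 0)
    (hreg : LinearIndependent ℂ fun i : Fin k => dAt hx (A.Y ξ i.castSucc)) :
    x ∈ A.crit (fun j => ∑ i, a i * (nu ξ i j : ℂ)) ↔
      ∀ i : Fin k, A.Phi ξ x i.castSucc =
        a i.castSucc.succ / b i.castSucc.succ / (a 0 / b 0) := by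
  have hU := A.mem_U_iff.2 hx
  have hy := A.Phi_ne_zero ξ hU
  have hrel := A.Phi_relation hY hU
  have hdrel := A.dAt_relation hY hx
  have hom : ∀ i, A.omegaFamily ξ i ⟨x, hU⟩ = (A.Phi ξ x i)⁻¹ • dAt hx (A.Y ξ i) := fun i => by
    rw [dAt_Y, smul_smul, inv_mul_cancel₀ (hy i), one_smul]
  have hcrit : x ∈ A.crit (fun j => ∑ i, a i * (nu ξ i j : ℂ)) ↔
      ∑ i, (a i.succ * (A.Phi ξ x i)⁻¹) • dAt hx (A.Y ξ i) = 0 := by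
    simp only [crit, Set.mem_ofPred_eq, A.omega_weights ξ ha, hom, smul_smul]
    exact ⟨fun ⟨_, h⟩ => h, fun h => ⟨hU, h⟩⟩
  have hasum : a 0 + ∑ i : Fin (k + 1), a i.succ = 0 :=
    (Fin.sum_univ_succ a).symm.trans ha
  rw [hcrit]
  constructor
  · intro h0
    -- Chosen so that subtracting `r` times the relation removes the last differential; the
    -- remaining `k` are independent.
    set r := a (Fin.last k).succ * (A.Phi ξ x (Fin.last k))⁻¹ / b (Fin.last k).succ with hr
    have h1 : ∑ i, (a i.succ * (A.Phi ξ x i)⁻¹ - r * b i.succ) • dAt hx (A.Y ξ i) = 0 := by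
      simp only [sub_smul, Finset.sum_sub_distrib, mul_smul, ← Finset.smul_sum, hdrel, smul_zero,
        sub_zero] at h0 ⊢
      exact h0
    have hlast : a (Fin.last k).succ * (A.Phi ξ x (Fin.last k))⁻¹ - r * b (Fin.last k).succ = 0 := by
      rw [hr, div_mul_cancel₀ _ (hb _), sub_self]
    rw [Fin.sum_univ_castSucc, hlast, zero_smul, add_zero] at h1
    have h2 := Fintype.linearIndependent_iff.1 hreg _ h1
    have h3 : ∀ i : Fin (k + 1), a i.succ = r * (b i.succ * A.Phi ξ x i) := by
      intro i
      have h4 : a i.succ * (A.Phi ξ x i)⁻¹ - r * b i.succ = 0 := by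
        induction i using Fin.lastCases with
        | cast i => exact h2 i
        | last => exact hlast
      rw [sub_eq_zero, ← div_eq_mul_inv, div_eq_iff (hy i)] at h4
      rw [h4, mul_assoc]
    have h5 : a 0 = r * b 0 := by
      simp only [h3, ← Finset.mul_sum] at hasum
      linear_combination hasum - r * hrel
    have hr0 : r ≠ 0 := by
      intro h
      exact ha0 (by rw [h5, h, zero_mul])
    intro i
    have := hb 0
    have := hb i.castSucc.succ
    rw [h3, h5]
    field_simp
  · intro h0
    have h1 : ∀ i : Fin (k + 1), a i.succ * (A.Phi ξ x i)⁻¹ = a 0 / b 0 * b i.succ := by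
      have hcast : ∀ i : Fin k, b i.castSucc.succ * A.Phi ξ x i.castSucc =
          a i.castSucc.succ * (b 0 / a 0) := by
        intro i
        have := hb 0
        have := hb i.castSucc.succ
        rw [h0 i]
        field_simp
      intro i
      have hb0 := hb 0
      have h2 : b i.succ * A.Phi ξ x i = a i.succ * (b 0 / a 0) := by
        induction i using Fin.lastCases with
        | cast i => exact hcast i
        | last =>
          -- The last coordinate is determined by the others through the hyperplane equation and Σ
          -- a_i = 0.
          rw [Fin.sum_univ_castSucc] at hrel hasum
          simp only [hcast, ← Finset.sum_mul] at hrel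
          have h3 : a 0 * (b 0 / a 0) = b 0 := by field_simp
          linear_combination hrel - (b 0 / a 0) * hasum + h3
      rw [← div_eq_mul_inv, div_eq_iff (hy i), mul_assoc, h2]
      field_simp
    simp only [h1, mul_smul, ← Finset.smul_sum, hdrel, smul_zero]

end Arrangement

end CritLocus

end

/-! ### Generic weights and the codimension of the fibre -/

open CritLocus in
theorem mainTheorem11 {ℓ n q : ℕ} (A : Arrangement ℓ n) (ξ : Fin q → Fin (n + 1) → ℤ)
    (hsum : ∀ i, ∑ j, ξ i j = 0)
    (hbasis : LinearIndependent ℂ (A.omegaFamily ξ))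
    (b : Fin (q + 1) → ℂ) (hb : ∀ j, b j ≠ 0)
    (hY : A.Ybar ξ = hyperplane b) :
    ForGenericWeights fun a : Fin (q + 1) → ℂ =>
      (A.crit (fun j => ∑ i, a i * (nu ξ i j : ℂ)) \ A.S ξ).Nonempty ∧
      ∀ Z, IsComponent (A.crit (fun j => ∑ i, a i * (nu ξ i j : ℂ)) \ A.S ξ) Z →
        codim Z = (A.rank (A.D ξ) : ℕ∞) := by
  open MvPolynomial Arrangement in
  obtain ⟨k, rfl⟩ := Nat.exists_eq_succ_of_ne_zero (A.q_ne_zero (hb 0) hY)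
  have hind := A.algebraicIndependent_Y hb hY
  obtain ⟨x₀, hx₀, hreg₀⟩ := A.exists_regular hb hY
  obtain ⟨P, hPx₀, hP⟩ := A.exists_basic_regular hx₀ hreg₀
  have hP0 : P ≠ 0 := by rintro rfl; exact hPx₀ (map_zero _)
  obtain ⟨G, hG0, hG⟩ := exists_point_of_eval_ne_zero hind hP0
  obtain ⟨N, H, -, hH⟩ := exists_homogenization G (0 : Fin (k + 1 + 1))
    (fun i : Fin k => i.castSucc.succ)
  have heval : ∀ a : Fin (k + 1 + 1) → ℂ,
      eval a (X 0 * bind₁ (fun j => C (b j)⁻¹ * X j) H) = a 0 * eval (fun j => a j / b j) H := by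
    intro a
    rw [map_mul, eval_X, ← aeval_eq_eval, aeval_bind₁, ← aeval_eq_eval]
    congr 2
    ext j
    simp [div_eq_inv_mul]
  -- The factor `X 0` ensures a_0 ≠ 0; the other one says that the target point, in its affine
  -- coordinates, avoids `G = 0`.
  refine ⟨X 0 * bind₁ (fun j => C (b j)⁻¹ * X j) H, ?_, ?_⟩
  · obtain ⟨t, ht⟩ : ∃ t, eval t G ≠ 0 := by
      by_contra! hcon
      exact hG0 (MvPolynomial.funext fun t => by simpa using hcon t)
    -- Weights whose target point has affine coordinates `t`; the last entry makes the sum zero.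
    refine ⟨Fin.cons (b 0) (Fin.snoc (α := fun _ => ℂ) (fun i : Fin k => b i.castSucc.succ * t i)
      (-(b 0 + ∑ i : Fin k, b i.castSucc.succ * t i))), ?_, ?_⟩
    · rw [Fin.sum_univ_succ, Fin.sum_univ_castSucc]
      simp
    · rw [heval, hH _ (by simp [hb 0])]
      simpa [hb] using ht
  · intro a ha haG
    rw [heval, mul_ne_zero_iff] at haG
    obtain ⟨ha0, haH⟩ := haG
    rw [hH _ (div_ne_zero ha0 (hb 0)), mul_ne_zero_iff] at haH
    obtain ⟨x, hx, hPx, hxY⟩ := hG _ haH.2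
    obtain ⟨_, hreg⟩ := hP x hPx
    refine ⟨⟨x, (A.mem_crit_iff hb hY ha ha0 hx hreg).2 fun i => ?_, ?_⟩, ?_⟩
    · rw [← evAt_Y _ _ hx, hxY]
    · exact (A.notMem_S_iff hb hY hx).2 hreg
    · intro Z hZ
      rw [A.rank_D hb hY]
      choose m Q hQ using fun i : Fin k => exists_numerator (A.Y ξ i.castSucc)
      let c : Fin k → ℂ := fun i => a i.castSucc.succ / b i.castSucc.succ / (a 0 / b 0)
      -- The fibre equations Y_i = c_i with denominators cleared.
      let g : Fin k → MvPolynomial (Fin ℓ) ℂ := fun i => Q i - C (c i) * A.defPoly ^ m i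
      let O : Set (Fin ℓ → ℂ) := A.U \ A.S ξ
      have hg : ∀ y (hy : eval y A.defPoly ≠ 0) i, eval y (g i) =
          (A.Phi ξ y i.castSucc - c i) * eval y A.defPoly ^ m i := by
        intro y hy i
        have := evAt_numerator hy (hQ i)
        rw [evAt_Y] at this
        simp only [g, map_sub, map_mul, eval_C, map_pow, ← this]
        ring
      have hW : A.crit (fun j => ∑ i, a i * (nu ξ i j : ℂ)) \ A.S ξ =
          {y ∈ O | ∀ i, eval y (g i) = 0} := by
        ext y
        constructor
        · rintro ⟨hyc, hyS⟩
          obtain ⟨hyU, -⟩ := id hyc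
          have hy := A.mem_U_iff.1 hyU
          refine ⟨⟨hyU, hyS⟩, fun i => ?_⟩
          rw [hg y hy, (A.mem_crit_iff hb hY ha ha0 hy ((A.notMem_S_iff hb hY hy).1 hyS)).1 hyc i,
            sub_self, zero_mul]
        · rintro ⟨⟨hyU, hyS⟩, hyg⟩
          have hy := A.mem_U_iff.1 hyU
          refine ⟨(A.mem_crit_iff hb hY ha ha0 hy ((A.notMem_S_iff hb hY hy).1 hyS)).2 fun i => ?_, hyS⟩
          have := hyg i
          rw [hg y hy] at this
          exact sub_eq_zero.1 ((mul_eq_zero.1 this).resolve_right (pow_ne_zero _ hy))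
      rw [hW] at hZ
      refine codim_eq_of_isComponent g ?_ ?_ hZ
      · let _ := zariski ℓ
        rw [isOpen_iff_forall_mem_open]
        rintro y ⟨hyU, hyS⟩
        have hy := A.mem_U_iff.1 hyU
        obtain ⟨P', hP'y, hP'⟩ := A.exists_basic_regular hy ((A.notMem_S_iff hb hY hy).1 hyS)
        refine ⟨{z | eval z P' ≠ 0}, fun z hz => ?_, isOpen_basic P', hP'y⟩
        obtain ⟨hz', hzreg⟩ := hP' z hz
        exact ⟨A.mem_U_iff.2 hz', (A.notMem_S_iff hb hY hz').2 hzreg⟩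
      · rintro y ⟨hyU, hyS⟩ hyg
        have hy := A.mem_U_iff.1 hyU
        have hne : ∀ i, eval y A.defPoly ^ m i ≠ 0 := fun i => pow_ne_zero _ hy
        obtain ⟨v, hv⟩ := exists_dual_vectors ((A.notMem_S_iff hb hY hy).1 hyS)
        -- On the fibre, clearing denominators only multiplies dY_i by this power of `defPoly`,
        -- which the rescaling undoes.
        refine ⟨fun i => (eval y A.defPoly ^ m i)⁻¹ • v i, fun i j => ?_⟩
        have h1 : algebraMap _ (Localization.Away A.defPoly) (g j) =
            (A.Y ξ j.castSucc - algebraMap ℂ _ (c j)) * algebraMap _ _ (A.defPoly ^ m j) := by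
          rw [sub_mul, map_pow, hQ, map_sub, map_mul, map_pow]
          rfl
        have h2 : evAt hy (A.Y ξ j.castSucc) = c j := by
          have := hyg j
          rw [hg y hy] at this
          rw [evAt_Y]
          exact sub_eq_zero.1 ((mul_eq_zero.1 this).resolve_right (hne j))
        have h3 : dAt hy (algebraMap _ _ (g j)) =
            eval y A.defPoly ^ m j • dAt hy (A.Y ξ j.castSucc) := by
          rw [h1, dAt_mul, map_sub, h2, AlgHom.commutes, Algebra.algebraMap_self, RingHom.id_apply,
            sub_self, zero_smul, zero_add, evAt_algebraMap, map_pow, sub_eq_add_neg, ← map_neg, dAt_add,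
            dAt_algebraMap, add_zero]
        rw [← dAt_algebraMap_apply hy, h3, LinearMap.smul_apply, map_smul, hv]
        split_ifs with hij
        · rw [hij]; simp [hne j]
        · simp
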